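/- Let $n\ge 2$ and let $Q_c^n$ be the simply connected $n$-dimensional space form of curvature $c\in\{0,1,-1\}$, i.e. $\mathbb R^n$ ($c=0$), the unit sphere $\mathbb S^n\subset\mathbb R^{n+1}$ ($c=1$), or the hyperbolic space $\mathbb H^n=\{x\in\mathbb L^{n+1} : \langle x,x\rangle=-1,\ x_{n+1}>0\}$ ($c=-1$), where $\mathbb L^{n+1}$ is $\mathbb R^{n+1}$ with the form $x_1y_1+\dots+x_ny_n-x_{n+1}y_{n+1}$. Endow $Q_c^n\times\mathbb R$ with the Riemannian product metric $\langle\,,\rangle=\langle\,,\rangle_{Q}+dt^2$; let $\langle\,,\rangle_L=\langle\,,\rangle_{Q}-dt^2$ be the Lorentzian product metric, and $\partial_t$ the unit vertical field. For an oriented hypersurface $\Sigma\subset Q_c^n\times\mathbb R$ with unit normal $N$ and shape operator $AX=-\overline\nabla_XN$, let $\xi$ be its height function (the restriction of the projection to $\mathbb R$) and $\theta=\langle N,\partial_t\rangle$ its angle function. $\Sigma$ is a *vertical helicoid* if $\xi$ has no critical points on $\Sigma$, $\theta$ is nonconstant, every horizontal section $\Sigma_t=\Sigma\cap(Q_c^n\times\{t\})$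 is a minimal hypersurface of $Q_c^n\times\{t\}$, and $\langle A\nabla\xi,\nabla\xi\rangle=0$ on $\Sigma$. A hypersurface is *spacelike* if $\langle\,,\rangle_L$ is positive definite on its tangent spaces; a spacelike hypersurface is *zero mean isocurved* if its mean curvatures with respect to $\langle\,,\rangle$ and to $\langle\,,\rangle_L$ both vanish identically. For a hypersurface $\Sigma_0\subset Q_c^n$, a one-parameter group $\{\Gamma_s\}_{s\in\mathbb R}$ of isometries of $Q_c^n$ and $a>0$, the *$a$-pitched twisting* of $\Sigma_0$ determined by $\{\Gamma_s\}$ is $\{(\Gamma_s(p),as) : p\in\Sigma_0,\ s\in\mathbb R\}\subset Q_c^n\times\mathbb R$. For $k>0$ and $s\in\mathbb R$ let $\Gamma_s(k)$ be the linear map of the ambient space ($\mathbb R^n$, $\mathbb R^{n+1}$ or $\mathbb L^{n+1}$, respectively) that rotates each of the coordinate planes $(x_1,x_2),(x_3,x_4),\dots$ by the angle $ks$; here the planes are those formed from the first $d$ coordinates, with $d=n,\,n+1,\,n$ for $c=0,1,-1$, and all remaining coordinates (including $x_d$ if $d$ is odd) are fixed. **Theorem.** For every $k>0$, $\{\Gamma_s(k)\}_{s\in\mathbb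 R}$ restricts to a one-parameter group of isometries of $Q_c^n$. There are a totally geodesic hypersurface $\Sigma_0\subset Q_c^n$ and a two-parameter family $\{\Sigma(a,k) : a,k>0\}$ of properly embedded vertical helicoids in $Q_c^n\times\mathbb R$ such that, for all $a,k>0$, $\Sigma(a,k)$ is the $a$-pitched twisting of $\Sigma_0$ determined by $\{\Gamma_s(k)\}_{s\in\mathbb R}$, and every horizontal section of $\Sigma(a,k)$ is of the form $L\times\{t\}$ with $L$ a totally geodesic hypersurface of $Q_c^n$. Furthermore, for every $a>0$ there is $k>0$ such that $\Sigma(a,k)$ contains a nonempty open subset that is spacelike and zero mean isocurved. -/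

import Mathlib

open scoped ContDiff Topology

noncomputable section

namespace Helicoid

/-! ## Submanifolds of a flat pseudo-Euclidean space

`E` is a finite-dimensional real vector space with a constant symmetric bilinear form
`G : E → E → ℝ`, and `P ⊆ E` is a submanifold on which `G` restricts to a nondegenerate metric.
The Levi-Civita connection of `P` is the tangential part of the flat derivative of `E`, hence
`G (∇_X N) Y = G (D_X N) Y` for all `Y` tangent to `P`. -/

section General

variable {E : Type*} [NormedAddCommGroup E] [NormedSpace ℝ E]

/-- The tangent space of `S` at `x`: generated by the velocities of smooth curves of `S` through
`x` (for an embedded submanifold these velocities already form a linear subspace). -/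
def tangentSpace (S : Set E) (x : E) : Submodule ℝ E :=
  Submodule.span ℝ {v | ∃ γ : ℝ → E, ContDiffAt ℝ ∞ γ 0 ∧ (∀ᶠ s in 𝓝 (0 : ℝ), γ s ∈ S) ∧
    γ 0 = x ∧ deriv γ 0 = v}

/-- `S` is an embedded smooth hypersurface of the submanifold `P`: locally it is the zero set in
`P` of a smooth function whose differential does not vanish on the tangent space of `P`. -/
def IsHypersurface (P S : Set E) : Prop :=
  S ⊆ P ∧ ∀ x ∈ S, ∃ (U : Set E) (f : E → ℝ), IsOpen U ∧ x ∈ U ∧ ContDiffOn ℝ ∞ f U ∧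
    S ∩ U = {y | y ∈ P ∧ y ∈ U ∧ f y = 0} ∧ ∃ v ∈ tangentSpace P x, fderiv ℝ f x v ≠ 0

/-- `S` is an embedded hypersurface of `P` and its inclusion into `P` is a proper map. -/
def IsProperlyEmbeddedHypersurface (P S : Set E) : Prop :=
  IsHypersurface P S ∧ ∃ h : S ⊆ P, IsProperMap (Set.inclusion h)

/-- `N` is a smooth normal field with `G(N,N) = ε` along the part of `S` that lies in the open
set `U`. The field is tangent to `P`, orthogonal to `S`, and given together with a smooth
extension to `U`. -/
def IsUnitNormalOn (G : E → E → ℝ) (ε : ℝ) (P S U : Set E) (N : E → E) : Prop :=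
  IsOpen U ∧ ContDiffOn ℝ ∞ N U ∧ ∀ x ∈ S, x ∈ U →
    N x ∈ tangentSpace P x ∧ G (N x) (N x) = ε ∧ ∀ X ∈ tangentSpace S x, G (N x) X = 0

/-- The second fundamental form `⟨A X, Y⟩ = -⟨∇_X N, Y⟩` at `x`, for `X`, `Y` tangent to the
hypersurface. -/
def secondForm (G : E → E → ℝ) (N : E → E) (x X Y : E) : ℝ :=
  -G (fderiv ℝ N x X) Y

/-- `A` is the shape operator of `S` at `x` with respect to the normal field `N`. -/
def IsShapeOperator (G : E → E → ℝ) (S : Set E) (N : E → E) (x : E)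
    (A : tangentSpace S x →ₗ[ℝ] tangentSpace S x) : Prop :=
  ∀ X Y : tangentSpace S x, G (A X) Y = secondForm G N x X Y

/-- The (non normalized) mean curvature `trace A` of `S` at `x` is `H`. -/
def HasMeanCurvatureAt (G : E → E → ℝ) (S : Set E) (N : E → E) (x : E) (H : ℝ) : Prop :=
  ∃ A : tangentSpace S x →ₗ[ℝ] tangentSpace S x,
    IsShapeOperator G S N x A ∧ LinearMap.trace ℝ _ A = H

/-- `S` is a minimal hypersurface of the Riemannian submanifold `(P, G)`. -/
def IsMinimalHypersurface (G : E → E → ℝ) (P S : Set E) : Prop :=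
  IsHypersurface P S ∧ ∀ x ∈ S, ∃ (U : Set E) (N : E → E), x ∈ U ∧
    IsUnitNormalOn G 1 P S U N ∧ HasMeanCurvatureAt G S N x 0

/-- `S` is a totally geodesic hypersurface of the Riemannian submanifold `(P, G)`: its second
fundamental form vanishes. -/
def IsTotallyGeodesicHypersurface (G : E → E → ℝ) (P S : Set E) : Prop :=
  IsHypersurface P S ∧ ∀ x ∈ S, ∃ (U : Set E) (N : E → E), x ∈ U ∧
    IsUnitNormalOn G 1 P S U N ∧
    ∀ X ∈ tangentSpace S x, ∀ Y ∈ tangentSpace S x, secondForm G N x X Y = 0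

/-- `φ` restricts to an isometry of the Riemannian submanifold `(P, G)`. -/
def IsIsometryOf (G : E → E → ℝ) (P : Set E) (φ : E → E) : Prop :=
  Set.BijOn φ P P ∧ (∃ U : Set E, IsOpen U ∧ P ⊆ U ∧ ContDiffOn ℝ ∞ φ U) ∧
    ∀ x ∈ P, ∀ X ∈ tangentSpace P x, ∀ Y ∈ tangentSpace P x,
      G (fderiv ℝ φ x X) (fderiv ℝ φ x Y) = G X Y

/-- `Γ` restricts to a (smooth) one-parameter group of isometries of `(P, G)`. -/
def IsOneParameterIsometryGroup (G : E → E → ℝ) (P : Set E) (Γ : ℝ → E → E) : Prop :=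
  (∀ s, IsIsometryOf G P (Γ s)) ∧ (∀ x ∈ P, Γ 0 x = x) ∧
    (∀ s t, ∀ x ∈ P, Γ (s + t) x = Γ s (Γ t x)) ∧
    ∃ U : Set E, IsOpen U ∧ P ⊆ U ∧
      ContDiffOn ℝ ∞ (fun z : ℝ × E => Γ z.1 z.2) (Set.univ ×ˢ U)

/-! ## Hypersurfaces of products `Q × ℝ`

In this part `Q ⊆ E` is a Riemannian submanifold with metric `g`. -/

/-- The Riemannian product metric `g + dt²`. -/
def riemProd (g : E → E → ℝ) (X Y : E × ℝ) : ℝ := g X.1 Y.1 + X.2 * Y.2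

/-- The Lorentzian product metric `g - dt²`. -/
def lorProd (g : E → E → ℝ) (X Y : E × ℝ) : ℝ := g X.1 Y.1 - X.2 * Y.2

/-- The product `Q × ℝ`. -/
def prodLine (Q : Set E) : Set (E × ℝ) := Q ×ˢ Set.univ

/-- The horizontal section `Q × {t}`. -/
def slice (Q : Set E) (t : ℝ) : Set (E × ℝ) := Q ×ˢ {t}

/-- The angle function `⟨N, ∂_t⟩`. -/
def angle (g : E → E → ℝ) (N : E × ℝ → E × ℝ) (x : E × ℝ) : ℝ := riemProd g (N x) (0, 1)

/-- `x` is a horizontal point of `S`, i.e. a critical point of the height function. -/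
def IsHorizontalPoint (S : Set (E × ℝ)) (x : E × ℝ) : Prop :=
  ∀ X ∈ tangentSpace S x, X.2 = 0

/-- `Z` is the gradient at `x` of the height function of `S`, with respect to `g + dt²`. -/
def IsHeightGradient (g : E → E → ℝ) (S : Set (E × ℝ)) (x Z : E × ℝ) : Prop :=
  Z ∈ tangentSpace S x ∧ ∀ X ∈ tangentSpace S x, riemProd g Z X = X.2

/-- `S` is an (embedded) vertical helicoid of `Q × ℝ`: an orientable hypersurface with no
horizontal points and nonconstant angle function, whose horizontal sections are minimal and such
that the gradient of the height function is an asymptotic direction. -/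
def IsVerticalHelicoid (g : E → E → ℝ) (Q : Set E) (S : Set (E × ℝ)) : Prop :=
  IsHypersurface (prodLine Q) S ∧ (∀ x ∈ S, ¬ IsHorizontalPoint S x) ∧
    (∀ t : ℝ, IsMinimalHypersurface (riemProd g) (slice Q t) (S ∩ slice Q t)) ∧
    ∃ (U : Set (E × ℝ)) (N : E × ℝ → E × ℝ), S ⊆ U ∧
      IsUnitNormalOn (riemProd g) 1 (prodLine Q) S U N ∧
      (∃ x ∈ S, ∃ y ∈ S, angle g N x ≠ angle g N y) ∧
      ∀ x ∈ S, ∃ Z, IsHeightGradient g S x Z ∧ secondForm (riemProd g) N x Z Z = 0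

/-- The Lorentzian metric is positive definite on `S`. -/
def IsSpacelike (g : E → E → ℝ) (S : Set (E × ℝ)) : Prop :=
  ∀ x ∈ S, ∀ X ∈ tangentSpace S x, X ≠ 0 → 0 < lorProd g X X

/-- `S` is a spacelike hypersurface of `Q × ℝ` whose Riemannian mean curvature `trace A` and
Lorentzian mean curvature `-trace A_L` are both equal to the function `H`. -/
def IsMeanIsocurvedWith (g : E → E → ℝ) (Q : Set E) (S : Set (E × ℝ)) (H : E × ℝ → ℝ) : Prop :=
  IsHypersurface (prodLine Q) S ∧ IsSpacelike g S ∧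
    ∃ (U : Set (E × ℝ)) (N NL : E × ℝ → E × ℝ), S ⊆ U ∧
      IsUnitNormalOn (riemProd g) 1 (prodLine Q) S U N ∧
      IsUnitNormalOn (lorProd g) (-1) (prodLine Q) S U NL ∧
      ∀ x ∈ S, HasMeanCurvatureAt (riemProd g) S N x (H x) ∧
        HasMeanCurvatureAt (lorProd g) S NL x (-H x)

/-- `S` is zero mean isocurved. -/
def IsZeroMeanIsocurved (g : E → E → ℝ) (Q : Set E) (S : Set (E × ℝ)) : Prop :=
  IsMeanIsocurvedWith g Q S (fun _ => 0)

/-- The `a`-pitched twisting of `S₀` determined by `Γ`. -/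
def pitchedTwisting (a : ℝ) (Γ : ℝ → E → E) (S₀ : Set E) : Set (E × ℝ) :=
  {z | ∃ p ∈ S₀, ∃ s : ℝ, z = (Γ s p, a * s)}

end General

/-! ## The simply connected space forms of curvature `0`, `1`, `-1` -/

/-- The three types of simply connected space forms. -/
inductive SpaceForm
  | euclidean
  | spherical
  | hyperbolic

/-- The dimension of the space in which the `n`-dimensional space form stands. -/
def ambDim : SpaceForm → ℕ → ℕ
  | .euclidean, n => n
  | .spherical, n => n + 1
  | .hyperbolic, n => n + 1

/-- The ambient coordinate space: `ℝ^n` for `ℝ^n`, `ℝ^{n+1}` for `S^n`, and the vector space of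
the Lorentz space `L^{n+1}` for `H^n`. -/
abbrev Amb (c : SpaceForm) (n : ℕ) : Type := Fin (ambDim c n) → ℝ

/-- The flat form of the ambient space: `∑ x_i y_i`, and in the hyperbolic case
`∑_{i<n} x_i y_i - x_n y_n` (coordinates are numbered from `0`). -/
def metric : (c : SpaceForm) → (n : ℕ) → Amb c n → Amb c n → ℝ
  | .euclidean, n => fun x y : Fin n → ℝ => ∑ i, x i * y i
  | .spherical, n => fun x y : Fin (n + 1) → ℝ => ∑ i, x i * y i
  | .hyperbolic, n => fun x y : Fin (n + 1) → ℝ =>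
      (∑ i : Fin n, x i.castSucc * y i.castSucc) - x (Fin.last n) * y (Fin.last n)

/-- The space form: `ℝ^n`, the unit sphere `S^n`, or the upper sheet `H^n` of the hyperboloid. -/
def Q : (c : SpaceForm) → (n : ℕ) → Set (Amb c n)
  | .euclidean, _ => Set.univ
  | .spherical, n => {x | metric .spherical n x x = 1}
  | .hyperbolic, n => {x : Fin (n + 1) → ℝ | metric .hyperbolic n x x = -1 ∧ 0 < x (Fin.last n)}

/-- The `j`-th coordinate of `x`, for an arbitrary natural number `j`. -/
def coord {m : ℕ} (x : Fin m → ℝ) (j : ℕ) : ℝ := if h : j < m then x ⟨j, h⟩ else 0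

/-- The block diagonal matrix acting on the first `d` coordinates by the `2 × 2` rotations of
angle `φ` in the coordinate planes `(0,1), (2,3), …` (the last of the `d` coordinates is fixed if
`d` is odd) and by the identity on the other coordinates. -/
def blockRotation (m d : ℕ) (φ : ℝ) (x : Fin m → ℝ) : Fin m → ℝ := fun i =>
  if 2 * (i.val / 2) + 1 < d then
    if i.val % 2 = 0 then Real.cos φ * x i - Real.sin φ * coord x (i.val + 1)
    else Real.sin φ * coord x (i.val - 1) + Real.cos φ * x i
  else x i

/-- The number of coordinates on which the rotation blocks are placed. -/
def rotDim : SpaceForm → ℕ → ℕ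
  | .euclidean, n => n
  | .spherical, n => n + 1
  | .hyperbolic, n => n

/-- The one-parameter group `s ↦ Γ_s(k)`. -/
def Gam (c : SpaceForm) (n : ℕ) (k s : ℝ) : Amb c n → Amb c n :=
  blockRotation (ambDim c n) (rotDim c n) (k * s)

end Helicoid

end

open scoped ContDiff Topology

noncomputable section

namespace Helicoid

/-! ### Tangent spaces generated by curves, and their behaviour in open subsets, slices and
products. -/

section General

variable {E : Type*} [NormedAddCommGroup E] [NormedSpace ℝ E]

/-! Each space form is an open piece of a quadric κ B(x,x) = κ² in a flat space (E, B), where κ = c;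
for κ = 0 the equation is empty. Let η(φ) be e₀ turned by the angle φ in a B-orthonormal plane (e₀,
e₁), let ν = η', and put w = k/a. The rotations Γ_s(k) preserve B and carry e₀ to η(ks), so the
a-pitched twisting of Q ∩ e₀^⊥ is Σ = {(x,t) : x ∈ Q, B(η(wt), x) = 0}. The geometry of Σ is then
linear algebra on this equation.

A horizontal section is Q ∩ η^⊥. It has the constant normal η, hence is totally geodesic. Put u =
B(ν, x) and treat both metrics at once as B + ε dt² with ε = ±1. Then (η, εwu) is normal to Σ, and
the second fundamental form is, up to a scalar, the symmetric product of the linear forms dt and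
B(ν, ·) on the tangent space. The first is represented by a multiple of Z = (-wuη, 1), the second by
a horizontal vector V. Since ν is orthogonal to η, B(ν, ·) vanishes on Z. So Z, which is parallel to
∇ξ when ε = 1, is asymptotic, and the shape operator is traceless for both signs of ε.

The Lorentzian metric is positive on Σ where (wu)² > 1, and k = 2a makes this region nonempty. The
main lemmas are `IsQuadric.mem_tangentSpace_twist_iff`, `IsQuadric.secondForm_unitConormal`,
`IsQuadric.hasMeanCurvatureAt_twist` and `pitchedTwisting_blockRotation`. -/

theorem mem_tangentSpace_of_curve {S : Set E} {x v : E} {γ : ℝ → E} (hγ : ContDiffAt ℝ ∞ γ 0)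
    (hS : ∀ᶠ s in 𝓝 (0 : ℝ), γ s ∈ S) (h0 : γ 0 = x) (hv : HasDerivAt γ v 0) :
    v ∈ tangentSpace S x :=
  Submodule.subset_span ⟨γ, hγ, hS, h0, hv.deriv⟩

theorem tangentSpace_le {S : Set E} {x : E} (W : Submodule ℝ E)
    (h : ∀ (γ : ℝ → E) (v : E), HasDerivAt γ v 0 → (∀ᶠ s in 𝓝 (0 : ℝ), γ s ∈ S) → γ 0 = x →
      v ∈ W) : tangentSpace S x ≤ W := by
  refine Submodule.span_le.2 ?_
  rintro v ⟨γ, hγ, hS, h0, rfl⟩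
  exact h γ _ ((hγ.differentiableAt (by simp)).hasDerivAt) hS h0

/-- A function vanishing along a curve has zero derivative there. -/
theorem eq_zero_of_hasDerivAt_of_eventually {f : ℝ → ℝ} {f' : ℝ} (hf : HasDerivAt f f' 0)
    (h : ∀ᶠ s in 𝓝 (0 : ℝ), f s = 0) : f' = 0 := by
  have h1 : HasDerivAt (fun _ : ℝ => (0 : ℝ)) f' 0 :=
    hf.congr_of_eventuallyEq (h.mono fun s hs => hs.symm)
  exact h1.unique (hasDerivAt_const _ _)

/-- A curve through a point of an open set stays there for small times. This is what lets curvature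
computations pass to the spacelike part. -/
theorem tangentSpace_inter_open {S O : Set E} (hO : IsOpen O) {x : E} (hx : x ∈ O) :
    tangentSpace (S ∩ O) x = tangentSpace S x := by
  unfold tangentSpace
  congr 1
  ext v
  constructor
  · rintro ⟨γ, hγ, hS, h0, hv⟩
    exact ⟨γ, hγ, hS.mono fun s hs => hs.1, h0, hv⟩
  · rintro ⟨γ, hγ, hS, h0, hv⟩
    refine ⟨γ, hγ, ?_, h0, hv⟩
    have : ∀ᶠ s in 𝓝 (0 : ℝ), γ s ∈ O :=
      hγ.continuousAt.eventually_mem (hO.mem_nhds (by rwa [h0]))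
    filter_upwards [hS, this] with s h1 h2 using ⟨h1, h2⟩

theorem IsHypersurface.inter_open {P S O : Set E} (h : IsHypersurface P S) (hO : IsOpen O) :
    IsHypersurface P (S ∩ O) := by
  refine ⟨fun x hx => h.1 hx.1, fun x hx => ?_⟩
  obtain ⟨U, f, hU, hxU, hf, hS, hv⟩ := h.2 x hx.1
  refine ⟨U ∩ O, f, hU.inter hO, ⟨hxU, hx.2⟩, hf.mono Set.inter_subset_left, ?_, hv⟩
  ext y
  have := Set.ext_iff.1 hS y
  simp only [Set.mem_inter_iff, Set.mem_ofPred_eq] at this ⊢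
  tauto

theorem tangentSpace_slice {Q : Set E} {x v : E} {t : ℝ} (hv : v ∈ tangentSpace Q x) :
    ((v, 0) : E × ℝ) ∈ tangentSpace (slice Q t) (x, t) := by
  have key : tangentSpace Q x ≤
      (tangentSpace (slice Q t) (x, t)).comap (LinearMap.inl ℝ E ℝ) := by
    refine Submodule.span_le.2 ?_
    rintro v ⟨γ, hγ, hS, h0, rfl⟩
    have hd := (hγ.differentiableAt (by simp)).hasDerivAt
    exact mem_tangentSpace_of_curve (γ := fun s => (γ s, t)) (hγ.prodMk contDiffAt_const)
      (hS.mono fun s hs => ⟨hs, rfl⟩) (by simp [h0]) (hd.prodMk (hasDerivAt_const _ _))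
  exact key hv

theorem tangentSpace_slice_le {Q : Set E} {x : E} {t : ℝ} {X : E × ℝ}
    (hX : X ∈ tangentSpace (slice Q t) (x, t)) : X.1 ∈ tangentSpace Q x ∧ X.2 = 0 := by
  constructor
  · have key : tangentSpace (slice Q t) (x, t) ≤
        (tangentSpace Q x).comap (LinearMap.fst ℝ E ℝ) := by
      refine Submodule.span_le.2 ?_
      rintro v ⟨γ, hγ, hS, h0, rfl⟩
      have hd := (hγ.differentiableAt (by simp)).hasDerivAt
      exact mem_tangentSpace_of_curve (γ := fun s => (γ s).1) hγ.fst
        (hS.mono fun s hs => hs.1) (by simp [h0]) hd.fst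
    exact key hX
  · have key : tangentSpace (slice Q t) (x, t) ≤ LinearMap.ker (LinearMap.snd ℝ E ℝ) := by
      refine tangentSpace_le _ fun γ v hv hS h0 => ?_
      have h1 : HasDerivAt (fun s => (γ s).2 - t) v.2 0 := hv.snd.sub_const t
      exact eq_zero_of_hasDerivAt_of_eventually h1
        (hS.mono fun s hs => sub_eq_zero.2 hs.2)
    exact key hX

theorem tangentSpace_mono {S T : Set E} (h : S ⊆ T) (x : E) :
    tangentSpace S x ≤ tangentSpace T x := by
  refine Submodule.span_mono ?_
  rintro v ⟨γ, hγ, hS, h0, hv⟩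
  exact ⟨γ, hγ, hS.mono fun s hs => h hs, h0, hv⟩

theorem slice_subset_prodLine {F : Type*} (Q : Set F) (t : ℝ) : slice Q t ⊆ prodLine Q :=
  fun _ hz => ⟨hz.1, trivial⟩

theorem vertical_mem_tangentSpace_prodLine {Q : Set E} {x : E} {t : ℝ} (hx : x ∈ Q) :
    ((0, 1) : E × ℝ) ∈ tangentSpace (prodLine Q) (x, t) := by
  refine mem_tangentSpace_of_curve (γ := fun s => (x, t + s))
    (contDiffAt_const.prodMk (contDiffAt_const.add contDiffAt_id))
    (Filter.Eventually.of_forall fun s => ⟨hx, trivial⟩) (by simp) ?_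
  exact (hasDerivAt_const _ _).prodMk ((hasDerivAt_id (0 : ℝ)).const_add t)

theorem mem_tangentSpace_prodLine {Q : Set E} {z X : E × ℝ} (hz : z.1 ∈ Q)
    (hX : X.1 ∈ tangentSpace Q z.1) : X ∈ tangentSpace (prodLine Q) z := by
  have h1 : ((X.1, 0) : E × ℝ) ∈ tangentSpace (prodLine Q) z :=
    tangentSpace_mono (slice_subset_prodLine Q z.2) _ (tangentSpace_slice hX)
  have h2 := Submodule.smul_mem _ X.2 (vertical_mem_tangentSpace_prodLine (t := z.2) hz)
  have h3 := Submodule.add_mem _ h1 h2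
  simpa using h3

/-! ### Quadrics -/

theorem hasDerivAt_bilin (B : E →L[ℝ] E →L[ℝ] ℝ) {y w : ℝ → E} {y' w' : E} {s : ℝ}
    (hy : HasDerivAt y y' s) (hw : HasDerivAt w w' s) :
    HasDerivAt (fun s => B (y s) (w s)) (B y' (w s) + B (y s) w') s :=
  (B.hasFDerivAt.comp_hasDerivAt s hy).clm_apply hw

/-- `Q` is an open piece of the quadric `κ B(x,x) = κ²`, with `κ ∈ {0, 1, -1}` (for `κ = 0`
this is an open subset of `E`), on whose tangent spaces `B` is positive definite. -/
structure IsQuadric (B : E →L[ℝ] E →L[ℝ] ℝ) (κ : ℝ) (Q : Set E) : Prop where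
  symm : ∀ x y, B x y = B y x
  cube : κ ^ 3 = κ
  exists_open : ∃ O : Set E, IsOpen O ∧ ∀ x, x ∈ Q ↔ x ∈ O ∧ κ * B x x = κ ^ 2
  pos : ∀ x ∈ Q, ∀ v, κ * B x v = 0 → v ≠ 0 → 0 < B v v

variable {B : E →L[ℝ] E →L[ℝ] ℝ} {κ : ℝ} {Q : Set E}

theorem IsQuadric.eqn (hQ : IsQuadric B κ Q) {x : E} (hx : x ∈ Q) : κ * B x x = κ ^ 2 := by
  obtain ⟨O, -, h⟩ := hQ.exists_open
  exact ((h x).1 hx).2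

/-- A curve starting tangentially to the quadric can be rescaled to stay in it. -/
theorem IsQuadric.exists_rescaling (hQ : IsQuadric B κ Q) {x v : E} (hx : x ∈ Q) {y : ℝ → E}
    (hy : ContDiffAt ℝ ∞ y 0) (y0 : y 0 = x) (hd : HasDerivAt y v 0) (hv : κ * B x v = 0) :
    ∃ r : ℝ → ℝ, ContDiffAt ℝ ∞ r 0 ∧ (∀ᶠ s in 𝓝 (0 : ℝ), r s • y s ∈ Q) ∧ r 0 = 1 ∧
      HasDerivAt (fun s => r s • y s) v 0 := by
  obtain ⟨O, hO, hmem⟩ := hQ.exists_open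
  -- For κ = ±1 this is κ B(y,y), for κ = 0 it is constantly 1; dividing `y` by its square root
  -- lands on the quadric in every case.
  set h : ℝ → ℝ := fun s => 1 + κ * B (y s) (y s) - κ ^ 2 with hh
  have h0 : h 0 = 1 := by simp [hh, y0, hQ.eqn hx]
  have hc : ContDiffAt ℝ ∞ h 0 :=
    (contDiffAt_const.add (contDiffAt_const.mul
      ((B.contDiff.contDiffAt.comp 0 hy).clm_apply hy))).sub contDiffAt_const
  -- Tangency makes `h` stationary at 0, so the rescaling keeps the initial velocity.
  have hhd : HasDerivAt h 0 0 := by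
    have := (((hasDerivAt_bilin B hd hd).const_mul κ).const_add 1).sub_const (κ ^ 2)
    refine this.congr_deriv ?_
    rw [y0, hQ.symm v x]
    linear_combination 2 * hv
  have hpos : ∀ᶠ s in 𝓝 (0 : ℝ), 0 < h s :=
    hc.continuousAt.eventually (lt_mem_nhds (by rw [h0]; exact one_pos))
  have hrc : ContDiffAt ℝ ∞ (fun s => (Real.sqrt (h s))⁻¹) 0 :=
    (hc.sqrt (by rw [h0]; exact one_ne_zero)).inv (by rw [h0]; simp)
  have hr0 : (Real.sqrt (h 0))⁻¹ = 1 := by rw [h0]; simp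
  have hrd : HasDerivAt (fun s => (Real.sqrt (h s))⁻¹) 0 0 := by
    have := (hhd.sqrt (by rw [h0]; exact one_ne_zero)).inv (by rw [h0]; simp)
    exact this.congr_deriv (by simp)
  have hprod : HasDerivAt (fun s => (Real.sqrt (h s))⁻¹ • y s) v 0 := by
    have := hrd.smul hd
    refine this.congr_deriv ?_
    simp [hr0]
  refine ⟨_, hrc, ?_, hr0, hprod⟩
  have hOev : ∀ᶠ s in 𝓝 (0 : ℝ), (Real.sqrt (h s))⁻¹ • y s ∈ O := by
    refine hprod.continuousAt.eventually_mem (hO.mem_nhds ?_)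
    simp only [hr0, one_smul, y0]
    exact ((hmem x).1 hx).1
  filter_upwards [hpos, hOev] with s hs hsO
  refine (hmem _).2 ⟨hsO, ?_⟩
  have hsq : (Real.sqrt (h s))⁻¹ * (Real.sqrt (h s))⁻¹ = (h s)⁻¹ := by
    rw [← mul_inv, Real.mul_self_sqrt hs.le]
  have e1 : κ * B ((Real.sqrt (h s))⁻¹ • y s) ((Real.sqrt (h s))⁻¹ • y s)
      = (h s)⁻¹ * (κ * B (y s) (y s)) := by
    simp only [map_smul, smul_apply, smul_eq_mul]
    rw [← hsq]; ring
  rw [e1, inv_mul_eq_iff_eq_mul₀ hs.ne']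
  simp only [hh]
  linear_combination (κ - B (y s) (y s)) * hQ.cube

/-- Differentiating the equation gives one direction; rescaling the line x + sv into the quadric
gives the other. -/
theorem IsQuadric.mem_tangentSpace_iff (hQ : IsQuadric B κ Q) {x v : E} (hx : x ∈ Q) :
    v ∈ tangentSpace Q x ↔ κ * B x v = 0 := by
  constructor
  · intro hv
    have key : tangentSpace Q x ≤ LinearMap.ker (κ • (B x)).toLinearMap := by
      refine tangentSpace_le _ fun γ v hv hS h0 => ?_
      have h1 := ((hasDerivAt_bilin B hv hv).const_mul κ).sub_const (κ ^ 2)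
      have h2 := eq_zero_of_hasDerivAt_of_eventually h1
        (hS.mono fun s hs => sub_eq_zero.2 (hQ.eqn hs))
      rw [h0, hQ.symm v x] at h2
      simp only [LinearMap.mem_ker, ContinuousLinearMap.coe_coe, smul_apply,
        smul_eq_mul]
      linarith
    simpa using key hv
  · intro hv
    have hd : HasDerivAt (fun s : ℝ => x + s • v) v 0 := by
      simpa using ((hasDerivAt_id (0 : ℝ)).smul_const v).const_add x
    have hy : ContDiffAt ℝ ∞ (fun s : ℝ => x + s • v) 0 :=
      contDiffAt_const.add (contDiffAt_id.smul contDiffAt_const)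
    obtain ⟨r, hr, hrS, hr0, hrd⟩ := hQ.exists_rescaling hx hy (by simp) hd hv
    exact mem_tangentSpace_of_curve (hr.smul hy) hrS (by simp [hr0]) hrd

/-! ### Rotating frames and hyperplane sections -/

/-- The vector `e₀` rotated by the angle `φ` in the oriented plane `(e₀, e₁)`. -/
def rotDir (e₀ e₁ : E) (φ : ℝ) : E := Real.cos φ • e₀ + Real.sin φ • e₁

/-- The vector `e₁` rotated by the angle `φ` in the oriented plane `(e₀, e₁)`. -/
def rotNormal (e₀ e₁ : E) (φ : ℝ) : E := -Real.sin φ • e₀ + Real.cos φ • e₁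

/-- `(e₀, e₁)` is orthonormal with respect to `B`. -/
structure IsOrthonormalPair (B : E →L[ℝ] E →L[ℝ] ℝ) (e₀ e₁ : E) : Prop where
  symm : ∀ x y, B x y = B y x
  left : B e₀ e₀ = 1
  right : B e₁ e₁ = 1
  orth : B e₀ e₁ = 0

variable {e₀ e₁ : E}

theorem IsOrthonormalPair.dir_dir (h : IsOrthonormalPair B e₀ e₁) (φ : ℝ) :
    B (rotDir e₀ e₁ φ) (rotDir e₀ e₁ φ) = 1 := by
  simp only [rotDir, map_add, map_smul, add_apply,
    smul_apply, smul_eq_mul, h.left, h.right, h.orth, h.symm e₁ e₀]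
  linear_combination Real.sin_sq_add_cos_sq φ

theorem IsOrthonormalPair.normal_dir (h : IsOrthonormalPair B e₀ e₁) (φ : ℝ) :
    B (rotNormal e₀ e₁ φ) (rotDir e₀ e₁ φ) = 0 := by
  simp only [rotDir, rotNormal, map_add, map_smul, add_apply,
    smul_apply, smul_eq_mul, h.left, h.right, h.orth, h.symm e₁ e₀]
  ring

theorem hasDerivAt_rotDir (φ : ℝ) :
    HasDerivAt (rotDir e₀ e₁) (rotNormal e₀ e₁ φ) φ :=
  ((Real.hasDerivAt_cos φ).smul_const e₀).add ((Real.hasDerivAt_sin φ).smul_const e₁)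

theorem hasDerivAt_rotNormal (φ : ℝ) :
    HasDerivAt (rotNormal e₀ e₁) (-rotDir e₀ e₁ φ) φ := by
  have := ((Real.hasDerivAt_sin φ).neg.smul_const e₀).add
    ((Real.hasDerivAt_cos φ).smul_const e₁)
  refine this.congr_deriv ?_
  simp only [rotDir]
  module

theorem contDiff_rotDir : ContDiff ℝ ∞ (rotDir e₀ e₁) :=
  (Real.contDiff_cos.smul contDiff_const).add (Real.contDiff_sin.smul contDiff_const)

theorem contDiff_rotNormal : ContDiff ℝ ∞ (rotNormal e₀ e₁) :=
  (Real.contDiff_sin.neg.smul contDiff_const).add (Real.contDiff_cos.smul contDiff_const)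

/-- The section of `Q` by the hyperplane orthogonal to `η`. -/
def hyperplaneSection (B : E →L[ℝ] E →L[ℝ] ℝ) (Q : Set E) (η : E) : Set E :=
  {x | x ∈ Q ∧ B η x = 0}

/-- The constant field η is tangent to the quadric along the section, because B(x, η) = 0 there. It
is the unit normal, and its flat derivative vanishes. -/
theorem IsQuadric.isTotallyGeodesic_hyperplaneSection (hQ : IsQuadric B κ Q) {η : E}
    (hη : B η η = 1) :
    IsTotallyGeodesicHypersurface (fun x y => B x y) Q (hyperplaneSection B Q η) := by
  have htan : ∀ x ∈ hyperplaneSection B Q η, η ∈ tangentSpace Q x := fun x hx => by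
    rw [hQ.mem_tangentSpace_iff hx.1, hQ.symm, hx.2, mul_zero]
  refine ⟨⟨fun x hx => hx.1, fun x hx => ⟨Set.univ, B η, isOpen_univ, trivial,
    (B η).contDiff.contDiffOn, ?_, η, htan x hx, ?_⟩⟩, fun x hx => ⟨Set.univ, fun _ => η, trivial,
    ⟨isOpen_univ, contDiffOn_const, fun y hy _ => ⟨htan y hy, hη, fun X hX => ?_⟩⟩, ?_⟩⟩
  · ext y; simp [hyperplaneSection]
  · rw [ContinuousLinearMap.fderiv, hη]; exact one_ne_zero
  · have key : tangentSpace (hyperplaneSection B Q η) y ≤ LinearMap.ker (B η).toLinearMap := by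
      refine tangentSpace_le _ fun γ v hv hS h0 => ?_
      exact eq_zero_of_hasDerivAt_of_eventually ((B η).hasFDerivAt.comp_hasDerivAt 0 hv)
        (hS.mono fun s hs => hs.2)
    exact key hX
  · intro X _ Y _
    simp [secondForm]

/-- A totally geodesic hypersurface of `Q` gives a minimal hypersurface of each slice. -/
theorem IsTotallyGeodesicHypersurface.isMinimalHypersurface_slice {g : E → E → ℝ} {S : Set E}
    (h0 : ∀ x, g 0 x = 0) (h : IsTotallyGeodesicHypersurface g Q S) (t : ℝ) :
    IsMinimalHypersurface (riemProd g) (slice Q t) (S ×ˢ {t}) := by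
  have hsl : S ×ˢ {t} = slice S t := rfl
  rw [hsl]
  refine ⟨⟨fun z hz => ⟨h.1.1 hz.1, hz.2⟩, ?_⟩, ?_⟩
  · rintro ⟨x, t'⟩ ⟨hx, ht⟩
    obtain rfl : t' = t := ht
    obtain ⟨U, f, hU, hxU, hf, hS, v, hv, hfv⟩ := h.1.2 x hx
    refine ⟨U ×ˢ Set.univ, fun z => f z.1, hU.prod isOpen_univ, ⟨hxU, trivial⟩,
      hf.comp contDiffOn_fst fun z hz => hz.1, ?_, (v, 0), tangentSpace_slice hv, ?_⟩
    · ext z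
      have := Set.ext_iff.1 hS z.1
      simp only [slice, Set.mem_inter_iff, Set.mem_ofPred_eq, Set.mem_prod, Set.mem_univ,
        and_true] at this ⊢
      tauto
    · have hd : DifferentiableAt ℝ f x :=
        (hf.contDiffAt (hU.mem_nhds hxU)).differentiableAt (by simp)
      have h1 : HasFDerivAt (fun z : E × ℝ => f z.1)
          ((fderiv ℝ f x).comp (ContinuousLinearMap.fst ℝ E ℝ)) (x, t') :=
        HasFDerivAt.comp (x, t') hd.hasFDerivAt hasFDerivAt_fst
      rw [h1.fderiv]
      simpa using hfv
  · rintro ⟨x, t'⟩ ⟨hx, ht⟩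
    obtain rfl : t' = t := ht
    obtain ⟨U, N, hxU, hN, hII⟩ := h.2 x hx
    have hfd : HasFDerivAt (fun z : E × ℝ => ((N z.1, 0) : E × ℝ))
        ((((fderiv ℝ N x).comp (ContinuousLinearMap.fst ℝ E ℝ))).prod 0) (x, t') := by
      have hd : DifferentiableAt ℝ N x :=
        (hN.2.1.contDiffAt (hN.1.mem_nhds hxU)).differentiableAt (by simp)
      exact (HasFDerivAt.comp (x, t') hd.hasFDerivAt hasFDerivAt_fst).prodMk
        (hasFDerivAt_const _ _)
    -- The horizontal lift of `N` is the normal in the slice, and the zero map is its shape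
    -- operator.
    refine ⟨U ×ˢ Set.univ, fun z => (N z.1, 0), ⟨hxU, trivial⟩, ⟨hN.1.prod isOpen_univ,
      (hN.2.1.comp contDiffOn_fst fun z hz => hz.1).prodMk contDiffOn_const, ?_⟩, 0, ?_, by simp⟩
    · rintro ⟨y, s⟩ ⟨hy, hs⟩ hyU
      obtain rfl : s = t' := hs
      obtain ⟨h1, h2, h3⟩ := hN.2.2 y hy hyU.1
      refine ⟨tangentSpace_slice h1, by simpa [riemProd] using h2, fun X hX => ?_⟩
      have := tangentSpace_slice_le hX
      simp [riemProd, h3 _ this.1]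
    · intro X Y
      have hX := tangentSpace_slice_le X.2
      have hY := tangentSpace_slice_le Y.2
      have := hII _ hX.1 _ hY.1
      simp only [secondForm] at this
      simp only [secondForm, hfd.fderiv]
      simp [riemProd, this, h0]

end General

/-! ### The twisted hypersurface: tangent spaces and both metrics. -/

section Twist

variable {E : Type*} [NormedAddCommGroup E] [NormedSpace ℝ E]
  {B : E →L[ℝ] E →L[ℝ] ℝ} {κ : ℝ} {Q : Set E} {e₀ e₁ : E} {w ε : ℝ}

/-- Shape operators live on the tangent space as a type, so the equality is transported through
arbitrary subspaces, where it can be substituted. -/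
theorem HasMeanCurvatureAt.congr {G : E → E → ℝ} {S S' : Set E} {N : E → E} {x : E} {H : ℝ}
    (h : HasMeanCurvatureAt G S N x H) (hS : tangentSpace S x = tangentSpace S' x) :
    HasMeanCurvatureAt G S' N x H := by
  have key : ∀ T T' : Submodule ℝ E, T = T' →
      (∃ A : T →ₗ[ℝ] T, (∀ X Y : T, G (A X) Y = secondForm G N x X Y) ∧
        LinearMap.trace ℝ _ A = H) →
      ∃ A : T' →ₗ[ℝ] T', (∀ X Y : T', G (A X) Y = secondForm G N x X Y) ∧
        LinearMap.trace ℝ _ A = H := by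
    rintro T _ rfl h
    exact h
  exact key _ _ hS h

/-- The hypersurface of `Q × ℝ` whose section at height `t` is orthogonal to the vector `e₀`
rotated by the angle `w t`. -/
def twist (B : E →L[ℝ] E →L[ℝ] ℝ) (Q : Set E) (e₀ e₁ : E) (w : ℝ) : Set (E × ℝ) :=
  {z | z.1 ∈ Q ∧ B (rotDir e₀ e₁ (w * z.2)) z.1 = 0}

theorem hasDerivAt_rotDir_line (t τ : ℝ) :
    HasDerivAt (fun s : ℝ => rotDir e₀ e₁ (w * (t + s * τ)))
      ((w * τ) • rotNormal e₀ e₁ (w * t)) 0 := by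
  have h1 : HasDerivAt (fun s : ℝ => w * (t + s * τ)) (w * τ) 0 := by
    simpa using (((hasDerivAt_id (0 : ℝ)).mul_const τ).const_add t).const_mul w
  have h2 := (hasDerivAt_rotDir (e₀ := e₀) (e₁ := e₁) (w * (t + 0 * τ))).scomp 0 h1
  refine h2.congr_deriv ?_
  simp

theorem hasDerivAt_rotNormal_line (t τ : ℝ) :
    HasDerivAt (fun s : ℝ => rotNormal e₀ e₁ (w * (t + s * τ)))
      (-(w * τ) • rotDir e₀ e₁ (w * t)) 0 := by
  have h1 : HasDerivAt (fun s : ℝ => w * (t + s * τ)) (w * τ) 0 := by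
    simpa using (((hasDerivAt_id (0 : ℝ)).mul_const τ).const_add t).const_mul w
  have h2 := (hasDerivAt_rotNormal (e₀ := e₀) (e₁ := e₁) (w * (t + 0 * τ))).scomp 0 h1
  refine h2.congr_deriv ?_
  simp

theorem hasDerivAt_line (x v : E) : HasDerivAt (fun s : ℝ => x + s • v) v 0 := by
  simpa using ((hasDerivAt_id (0 : ℝ)).smul_const v).const_add x

/-- The two conditions are the linearizations of the two defining equations. Conversely, a line in
the given direction is corrected to a curve in the twist: project it orthogonally to the moving η,
then rescale it into the quadric. -/
theorem IsQuadric.mem_tangentSpace_twist_iff (hQ : IsQuadric B κ Q)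
    (he : IsOrthonormalPair B e₀ e₁) {z X : E × ℝ} (hz : z ∈ twist B Q e₀ e₁ w) :
    X ∈ tangentSpace (twist B Q e₀ e₁ w) z ↔ κ * B z.1 X.1 = 0 ∧
      B (rotDir e₀ e₁ (w * z.2)) X.1 + w * X.2 * B (rotNormal e₀ e₁ (w * z.2)) z.1 = 0 := by
  constructor
  · intro hX
    constructor
    · have key : tangentSpace (twist B Q e₀ e₁ w) z ≤
          LinearMap.ker ((κ • (B z.1)).comp (ContinuousLinearMap.fst ℝ E ℝ)).toLinearMap := by
        refine tangentSpace_le _ fun γ v hv hS h0 => ?_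
        have h1 := ((hasDerivAt_bilin B hv.fst hv.fst).const_mul κ).sub_const (κ ^ 2)
        have h2 := eq_zero_of_hasDerivAt_of_eventually h1
          (hS.mono fun s hs => sub_eq_zero.2 (hQ.eqn hs.1))
        rw [h0, hQ.symm v.1 z.1] at h2
        simp only [LinearMap.mem_ker, ContinuousLinearMap.coe_coe, smul_apply,
          ContinuousLinearMap.comp_apply, ContinuousLinearMap.coe_fst', smul_eq_mul]
        linarith
      simpa using key hX
    · have key : tangentSpace (twist B Q e₀ e₁ w) z ≤
          LinearMap.ker ((B (rotDir e₀ e₁ (w * z.2))).comp (ContinuousLinearMap.fst ℝ E ℝ) +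
            (w * B (rotNormal e₀ e₁ (w * z.2)) z.1) •
              ContinuousLinearMap.snd ℝ E ℝ).toLinearMap := by
        refine tangentSpace_le _ fun γ v hv hS h0 => ?_
        have h1 : HasDerivAt (fun s => rotDir e₀ e₁ (w * (γ s).2))
            ((w * v.2) • rotNormal e₀ e₁ (w * z.2)) 0 := by
          have h2 : HasDerivAt (fun s => w * (γ s).2) (w * v.2) 0 :=
            HasDerivAt.const_mul w (hv.snd : HasDerivAt (fun s => (γ s).2) v.2 0)
          have h3 := (hasDerivAt_rotDir (e₀ := e₀) (e₁ := e₁) (w * (γ 0).2)).scomp 0 h2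
          rw [h0] at h3
          exact h3
        have h2 := eq_zero_of_hasDerivAt_of_eventually (hasDerivAt_bilin B h1 hv.fst)
          (hS.mono fun s hs => hs.2)
        rw [h0] at h2
        simp only [map_smul, smul_apply, smul_eq_mul] at h2
        simp only [LinearMap.mem_ker, ContinuousLinearMap.coe_coe, smul_apply, add_apply,
          ContinuousLinearMap.comp_apply, ContinuousLinearMap.coe_fst',
          ContinuousLinearMap.coe_snd', smul_eq_mul]
        linarith
      have := key hX
      simp only [LinearMap.mem_ker, ContinuousLinearMap.coe_coe, smul_apply, add_apply,
        ContinuousLinearMap.comp_apply, ContinuousLinearMap.coe_fst',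
        ContinuousLinearMap.coe_snd', smul_eq_mul] at this
      linarith
  · rintro ⟨h1, h2⟩
    obtain ⟨x, t⟩ := z
    obtain ⟨v, τ⟩ := X
    obtain ⟨hx, hz⟩ := hz
    simp only at h1 h2 hx hz
    set η : ℝ → E := fun s => rotDir e₀ e₁ (w * (t + s * τ)) with hη
    have η0 : η 0 = rotDir e₀ e₁ (w * t) := by simp [hη]
    have hηc : ContDiff ℝ ∞ η :=
      contDiff_rotDir.comp (contDiff_const.mul (contDiff_const.add
        (contDiff_id.mul contDiff_const)))
    have hlc : ContDiff ℝ ∞ (fun s : ℝ => x + s • v) :=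
      contDiff_const.add (contDiff_id.smul contDiff_const)
    have hηd : HasDerivAt η ((w * τ) • rotNormal e₀ e₁ (w * t)) 0 := hasDerivAt_rotDir_line t τ
    have hcc : ContDiff ℝ ∞ (fun s => B (η s) (x + s • v)) :=
      (B.contDiff.comp hηc).clm_apply hlc
    -- The second linearized equation is exactly the vanishing of this derivative; hence removing
    -- the η-component does not change the velocity.
    have hcd : HasDerivAt (fun s => B (η s) (x + s • v)) 0 0 := by
      refine (hasDerivAt_bilin B hηd (hasDerivAt_line x v)).congr_deriv ?_
      simp only [η0, map_smul, smul_apply, smul_eq_mul, zero_smul, add_zero]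
      linarith
    have c0 : B (η 0) (x + (0 : ℝ) • v) = 0 := by simp [η0, hz]
    have hyc : ContDiff ℝ ∞ (fun s => x + s • v - B (η s) (x + s • v) • η s) :=
      hlc.sub (hcc.smul hηc)
    have hyd : HasDerivAt (fun s => x + s • v - B (η s) (x + s • v) • η s) v 0 := by
      refine ((hasDerivAt_line x v).sub (hcd.smul hηd)).congr_deriv ?_
      rw [c0]; simp
    obtain ⟨r, hr, hrS, hr0, hrd⟩ :=
      hQ.exists_rescaling hx hyc.contDiffAt (by simp [η0, hz]) hyd h1
    refine mem_tangentSpace_of_curve (γ := fun s => (r s • (x + s • v - B (η s) (x + s • v) • η s),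
      t + s * τ)) ((hr.smul hyc.contDiffAt).prodMk
        (contDiff_const.add (contDiff_id.mul contDiff_const)).contDiffAt) ?_ ?_ ?_
    · filter_upwards [hrS] with s hs
      refine ⟨hs, ?_⟩
      have : B (η s) (η s) = 1 := he.dir_dir _
      change B (η s) _ = 0
      -- The hyperplane equation is homogeneous, so rescaling into `Q` preserves it.
      rw [map_smul, map_sub, map_smul, this]
      simp
    · simp [η0, hz, hr0]
    · exact hrd.prodMk (hasDerivAt_line (E := ℝ) t τ)

/-- The pairing of the horizontal position with the rotated vector `e₁`. -/
def axisDist (B : E →L[ℝ] E →L[ℝ] ℝ) (e₀ e₁ : E) (w : ℝ) (z : E × ℝ) : ℝ :=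
  B (rotNormal e₀ e₁ (w * z.2)) z.1

/-- The product form `B + ε dt²`. -/
def prodForm (B : E →L[ℝ] E →L[ℝ] ℝ) (ε : ℝ) (X Y : E × ℝ) : ℝ := B X.1 Y.1 + ε * (X.2 * Y.2)

theorem riemProd_eq_prodForm : riemProd (fun x y => B x y) = prodForm B 1 := by
  funext X Y; simp [riemProd, prodForm]

theorem lorProd_eq_prodForm : lorProd (fun x y => B x y) = prodForm B (-1) := by
  funext X Y; simp [lorProd, prodForm]; ring

/-- A normal field of the twist with respect to `B + ε dt²`. -/
def conormal (B : E →L[ℝ] E →L[ℝ] ℝ) (e₀ e₁ : E) (w ε : ℝ) (z : E × ℝ) : E × ℝ :=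
  (rotDir e₀ e₁ (w * z.2), ε * w * axisDist B e₀ e₁ w z)

/-- The factor normalizing `conormal`. -/
def conormalScale (B : E →L[ℝ] E →L[ℝ] ℝ) (e₀ e₁ : E) (w ε : ℝ) (z : E × ℝ) : ℝ :=
  (Real.sqrt (ε + (w * axisDist B e₀ e₁ w z) ^ 2))⁻¹

/-- The unit normal of the twist with respect to `B + ε dt²`. -/
def unitConormal (B : E →L[ℝ] E →L[ℝ] ℝ) (e₀ e₁ : E) (w ε : ℝ) (z : E × ℝ) : E × ℝ :=
  conormalScale B e₀ e₁ w ε z • conormal B e₀ e₁ w ε z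

/-- The domain of `unitConormal`. -/
def conormalDomain (B : E →L[ℝ] E →L[ℝ] ℝ) (e₀ e₁ : E) (w ε : ℝ) : Set (E × ℝ) :=
  {z | 0 < ε + (w * axisDist B e₀ e₁ w z) ^ 2}

theorem contDiff_axisDist : ContDiff ℝ ∞ (axisDist B e₀ e₁ w) :=
  (B.contDiff.comp (contDiff_rotNormal.comp (contDiff_const.mul contDiff_snd))).clm_apply
    contDiff_fst

theorem contDiff_conormal : ContDiff ℝ ∞ (conormal B e₀ e₁ w ε) :=
  (contDiff_rotDir.comp (contDiff_const.mul contDiff_snd)).prodMk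
    (contDiff_const.mul contDiff_axisDist)

theorem isOpen_conormalDomain : IsOpen (conormalDomain B e₀ e₁ w ε) :=
  isOpen_lt continuous_const
    (continuous_const.add ((continuous_const.mul contDiff_axisDist.continuous).pow 2))

theorem conormalDomain_one : conormalDomain B e₀ e₁ w 1 = Set.univ := by
  ext z
  simp only [conormalDomain, Set.mem_ofPred_eq, Set.mem_univ, iff_true]
  positivity

theorem contDiffAt_conormalScale {z : E × ℝ} (hz : z ∈ conormalDomain B e₀ e₁ w ε) :
    ContDiffAt ℝ ∞ (conormalScale B e₀ e₁ w ε) z := by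
  have hz' : 0 < ε + (w * axisDist B e₀ e₁ w z) ^ 2 := hz
  have h : ContDiffAt ℝ ∞ (fun z => ε + (w * axisDist B e₀ e₁ w z) ^ 2) z :=
    contDiffAt_const.add ((contDiffAt_const.mul contDiff_axisDist.contDiffAt).pow 2)
  exact (h.sqrt hz'.ne').inv (Real.sqrt_pos.2 hz').ne'

theorem conormalScale_sq {z : E × ℝ} (hz : z ∈ conormalDomain B e₀ e₁ w ε) :
    conormalScale B e₀ e₁ w ε z ^ 2 * (ε + (w * axisDist B e₀ e₁ w z) ^ 2) = 1 := by
  have hz' : 0 < ε + (w * axisDist B e₀ e₁ w z) ^ 2 := hz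
  rw [conormalScale, inv_pow, Real.sq_sqrt hz'.le, inv_mul_cancel₀ hz'.ne']

/-- The factor ε in the vertical component cancels the one in the metric. For either sign the
conormal thus represents the differential of the twist equation. -/
theorem prodForm_conormal (hε : ε ^ 2 = 1) (z X : E × ℝ) :
    prodForm B ε (conormal B e₀ e₁ w ε z) X =
      B (rotDir e₀ e₁ (w * z.2)) X.1 + w * X.2 * B (rotNormal e₀ e₁ (w * z.2)) z.1 := by
  simp only [prodForm, conormal, axisDist]
  linear_combination (w * B (rotNormal e₀ e₁ (w * z.2)) z.1 * X.2) * hε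

theorem prodForm_smul_left (r : ℝ) (X Y : E × ℝ) :
    prodForm B ε (r • X) Y = r * prodForm B ε X Y := by
  simp [prodForm]; ring

theorem prodForm_smul_right (r : ℝ) (X Y : E × ℝ) :
    prodForm B ε X (r • Y) = r * prodForm B ε X Y := by
  simp [prodForm]; ring

theorem prodForm_add_left (X Y Z : E × ℝ) :
    prodForm B ε (X + Y) Z = prodForm B ε X Z + prodForm B ε Y Z := by
  simp [prodForm]; ring

theorem IsQuadric.rotDir_mem_tangentSpace (hQ : IsQuadric B κ Q) {z : E × ℝ}
    (hz : z ∈ twist B Q e₀ e₁ w) : rotDir e₀ e₁ (w * z.2) ∈ tangentSpace Q z.1 := by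
  rw [hQ.mem_tangentSpace_iff hz.1, hQ.symm, hz.2, mul_zero]

theorem IsQuadric.isUnitNormalOn_unitConormal (hQ : IsQuadric B κ Q)
    (he : IsOrthonormalPair B e₀ e₁) (hε : ε ^ 2 = 1) :
    IsUnitNormalOn (prodForm B ε) ε (prodLine Q) (twist B Q e₀ e₁ w)
      (conormalDomain B e₀ e₁ w ε) (unitConormal B e₀ e₁ w ε) := by
  refine ⟨isOpen_conormalDomain, fun z hz =>
    ((contDiffAt_conormalScale hz).smul contDiff_conormal.contDiffAt).contDiffWithinAt,
    fun z hz hzU => ⟨?_, ?_, fun X hX => ?_⟩⟩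
  · exact Submodule.smul_mem _ _ (mem_tangentSpace_prodLine hz.1 (hQ.rotDir_mem_tangentSpace hz))
  · rw [unitConormal, prodForm_smul_left, prodForm_smul_right, prodForm_conormal hε]
    simp only [conormal, he.dir_dir, axisDist]
    have := conormalScale_sq hzU
    simp only [axisDist] at this
    linear_combination ε * this - conormalScale B e₀ e₁ w ε z ^ 2 * hε
  · rw [unitConormal, prodForm_smul_left, prodForm_conormal hε,
      ((hQ.mem_tangentSpace_twist_iff he hz).1 hX).2, mul_zero]

/-- Differentiating ν in the vertical component produces a multiple of B(η, x), which vanishes on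
the twist. -/
theorem fderiv_conormal {z : E × ℝ} (hz : B (rotDir e₀ e₁ (w * z.2)) z.1 = 0) (X : E × ℝ) :
    fderiv ℝ (conormal B e₀ e₁ w ε) z X =
      ((w * X.2) • rotNormal e₀ e₁ (w * z.2), ε * w * B (rotNormal e₀ e₁ (w * z.2)) X.1) := by
  have hN : DifferentiableAt ℝ (conormal B e₀ e₁ w ε) z :=
    contDiff_conormal.contDiffAt.differentiableAt (n := ∞) (by simp)
  have hN' : HasFDerivAt (conormal B e₀ e₁ w ε) (fderiv ℝ (conormal B e₀ e₁ w ε) z)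
      (z + (0 : ℝ) • X) := by simpa using hN.hasFDerivAt
  have h1 := hN'.comp_hasDerivAt 0 (hasDerivAt_line z X)
  refine h1.unique ?_
  refine (hasDerivAt_rotDir_line z.2 X.2).prodMk ?_
  refine ((hasDerivAt_bilin B (hasDerivAt_rotNormal_line z.2 X.2)
    (hasDerivAt_line z.1 X.1)).const_mul (ε * w)).congr_deriv ?_
  simp [hz]

/-- The derivative of the normalizing factor contributes only a multiple of the conormal, which is
orthogonal to `Y`. What remains is a symmetric product of dt and B(ν, ·). -/
theorem IsQuadric.secondForm_unitConormal (hQ : IsQuadric B κ Q)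
    (he : IsOrthonormalPair B e₀ e₁) (hε : ε ^ 2 = 1) {z X Y : E × ℝ}
    (hz : z ∈ twist B Q e₀ e₁ w) (hzU : z ∈ conormalDomain B e₀ e₁ w ε)
    (hY : Y ∈ tangentSpace (twist B Q e₀ e₁ w) z) :
    secondForm (prodForm B ε) (unitConormal B e₀ e₁ w ε) z X Y =
      -(conormalScale B e₀ e₁ w ε z * w) * (X.2 * B (rotNormal e₀ e₁ (w * z.2)) Y.1 +
        Y.2 * B (rotNormal e₀ e₁ (w * z.2)) X.1) := by
  have hs : HasFDerivAt (conormalScale B e₀ e₁ w ε)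
      (fderiv ℝ (conormalScale B e₀ e₁ w ε) z) z :=
    ((contDiffAt_conormalScale hzU).differentiableAt (by simp)).hasFDerivAt
  have hM : HasFDerivAt (conormal B e₀ e₁ w ε) (fderiv ℝ (conormal B e₀ e₁ w ε) z) z :=
    (contDiff_conormal.contDiffAt.differentiableAt (n := ∞) (by simp)).hasFDerivAt
  have hN : HasFDerivAt (unitConormal B e₀ e₁ w ε) _ z := hs.smul hM
  rw [secondForm, hN.fderiv]
  simp only [add_apply, smul_apply, ContinuousLinearMap.smulRight_apply, prodForm_add_left,
    prodForm_smul_left, prodForm_conormal hε, ((hQ.mem_tangentSpace_twist_iff he hz).1 hY).2,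
    fderiv_conormal hz.2]
  simp only [prodForm, map_smul, smul_apply, smul_eq_mul]
  linear_combination (-conormalScale B e₀ e₁ w ε z * w * Y.2 *
    B (rotNormal e₀ e₁ (w * z.2)) X.1) * hε

/-- A multiple of the height gradient. -/
def ascent (B : E →L[ℝ] E →L[ℝ] ℝ) (e₀ e₁ : E) (w : ℝ) (z : E × ℝ) : E × ℝ :=
  (-(w * axisDist B e₀ e₁ w z) • rotDir e₀ e₁ (w * z.2), 1)

theorem IsQuadric.ascent_mem (hQ : IsQuadric B κ Q) (he : IsOrthonormalPair B e₀ e₁) {z : E × ℝ}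
    (hz : z ∈ twist B Q e₀ e₁ w) :
    ascent B e₀ e₁ w z ∈ tangentSpace (twist B Q e₀ e₁ w) z := by
  rw [hQ.mem_tangentSpace_twist_iff he hz]
  have h := hz.2
  rw [hQ.symm] at h
  simp only [ascent, map_smul, h, he.dir_dir, axisDist, smul_eq_mul]
  constructor <;> ring

/-- One vector represents a multiple of dt for both metrics; only the factor depends on ε. -/
theorem IsQuadric.prodForm_ascent (hQ : IsQuadric B κ Q) (he : IsOrthonormalPair B e₀ e₁)
    {z X : E × ℝ} (hz : z ∈ twist B Q e₀ e₁ w)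
    (hX : X ∈ tangentSpace (twist B Q e₀ e₁ w) z) :
    prodForm B ε (ascent B e₀ e₁ w z) X = (ε + (w * axisDist B e₀ e₁ w z) ^ 2) * X.2 := by
  have h := ((hQ.mem_tangentSpace_twist_iff he hz).1 hX).2
  simp only [prodForm, ascent, axisDist, map_smul, smul_apply, smul_eq_mul] at h ⊢
  linear_combination -(w * B (rotNormal e₀ e₁ (w * z.2)) z.1) * h

/-- This orthogonality yields both the asymptotic direction and half of the trace computation. -/
theorem IsOrthonormalPair.normal_ascent (he : IsOrthonormalPair B e₀ e₁) (z : E × ℝ) :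
    B (rotNormal e₀ e₁ (w * z.2)) (ascent B e₀ e₁ w z).1 = 0 := by
  simp [ascent, he.normal_dir]

/-- The projection of the rotated vector `e₁` to the tangent space of the twist. -/
def axisGrad (B : E →L[ℝ] E →L[ℝ] ℝ) (κ : ℝ) (e₀ e₁ : E) (w : ℝ) (z : E × ℝ) : E × ℝ :=
  (rotNormal e₀ e₁ (w * z.2) - (κ * axisDist B e₀ e₁ w z) • z.1, 0)

/-- Subtracting κux projects ν to the tangent space of the quadric; since ν and x are both
orthogonal to η, the result is also tangent to the twist. -/
theorem IsQuadric.axisGrad_mem (hQ : IsQuadric B κ Q) (he : IsOrthonormalPair B e₀ e₁)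
    {z : E × ℝ} (hz : z ∈ twist B Q e₀ e₁ w) :
    axisGrad B κ e₀ e₁ w z ∈ tangentSpace (twist B Q e₀ e₁ w) z := by
  rw [hQ.mem_tangentSpace_twist_iff he hz]
  have h1 := hQ.eqn hz.1
  have h2 := he.normal_dir (w * z.2)
  rw [hQ.symm] at h2
  simp only [axisGrad, map_sub, map_smul, hz.2, h2, axisDist, smul_eq_mul,
    hQ.symm z.1 (rotNormal e₀ e₁ (w * z.2))]
  constructor
  · linear_combination (-κ * B (rotNormal e₀ e₁ (w * z.2)) z.1) * h1 -
      B (rotNormal e₀ e₁ (w * z.2)) z.1 * hQ.cube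
  · ring

theorem IsQuadric.prodForm_axisGrad (hQ : IsQuadric B κ Q) (he : IsOrthonormalPair B e₀ e₁)
    {z X : E × ℝ} (hz : z ∈ twist B Q e₀ e₁ w)
    (hX : X ∈ tangentSpace (twist B Q e₀ e₁ w) z) :
    prodForm B ε (axisGrad B κ e₀ e₁ w z) X = B (rotNormal e₀ e₁ (w * z.2)) X.1 := by
  have h := ((hQ.mem_tangentSpace_twist_iff he hz).1 hX).1
  simp only [prodForm, axisGrad, axisDist, map_sub, map_smul, sub_apply, smul_apply,
    smul_eq_mul]
  linear_combination -(B (rotNormal e₀ e₁ (w * z.2)) z.1) * h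

/-- Replacing each factor of the second form by its dual vector gives a shape operator of rank at
most two, combining dt ⊗ V and B(ν, ·) ⊗ Z. Its trace combines dt(V) and B(ν, Z), which both vanish.
-/
theorem IsQuadric.hasMeanCurvatureAt_twist [FiniteDimensional ℝ E] (hQ : IsQuadric B κ Q)
    (he : IsOrthonormalPair B e₀ e₁) (hε : ε ^ 2 = 1) {z : E × ℝ}
    (hz : z ∈ twist B Q e₀ e₁ w) (hzU : z ∈ conormalDomain B e₀ e₁ w ε) :
    HasMeanCurvatureAt (prodForm B ε) (twist B Q e₀ e₁ w) (unitConormal B e₀ e₁ w ε) z 0 := by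
  have hpos : 0 < ε + (w * axisDist B e₀ e₁ w z) ^ 2 := hzU
  set T := tangentSpace (twist B Q e₀ e₁ w) z with hT
  let V : T := ⟨_, hQ.axisGrad_mem he hz⟩
  let Z : T := ⟨_, hQ.ascent_mem he hz⟩
  let ht : T →ₗ[ℝ] ℝ := (LinearMap.snd ℝ E ℝ).comp T.subtype
  let ax : T →ₗ[ℝ] ℝ :=
    ((B (rotNormal e₀ e₁ (w * z.2))).toLinearMap.comp (LinearMap.fst ℝ E ℝ)).comp T.subtype
  have htV : ht V = 0 := rfl
  have axZ : ax Z = 0 := he.normal_ascent z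
  refine ⟨-(conormalScale B e₀ e₁ w ε z * w) • (ht.smulRight V +
    (ε + (w * axisDist B e₀ e₁ w z) ^ 2)⁻¹ • ax.smulRight Z), fun X Y => ?_, ?_⟩
  · rw [hQ.secondForm_unitConormal he hε hz hzU Y.2]
    have h1 := hQ.prodForm_ascent (ε := ε) he hz Y.2
    have h2 := hQ.prodForm_axisGrad (ε := ε) he hz Y.2
    have e : ((-(conormalScale B e₀ e₁ w ε z * w) • (ht.smulRight V +
        (ε + (w * axisDist B e₀ e₁ w z) ^ 2)⁻¹ • ax.smulRight Z)) X : E × ℝ) =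
        -(conormalScale B e₀ e₁ w ε z * w) • ((X : E × ℝ).2 • axisGrad B κ e₀ e₁ w z +
        (ε + (w * axisDist B e₀ e₁ w z) ^ 2)⁻¹ • (B (rotNormal e₀ e₁ (w * z.2)) (X : E × ℝ).1 •
          ascent B e₀ e₁ w z)) := rfl
    simp only [e, prodForm_smul_left, prodForm_add_left, h1, h2]
    rw [mul_left_comm _ _ (_ * _), inv_mul_cancel_left₀ hpos.ne']
    ring
  · rw [map_smul, map_add, map_smul, LinearMap.trace_smulRight, LinearMap.trace_smulRight, htV,
      axZ]
    simp

/-! ### Proper embedding, the helicoid conditions and the spacelike part. -/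

theorem contDiff_twistEquation :
    ContDiff ℝ ∞ (fun z : E × ℝ => B (rotDir e₀ e₁ (w * z.2)) z.1) :=
  (B.contDiff.comp (contDiff_rotDir.comp (contDiff_const.mul contDiff_snd))).clm_apply
    contDiff_fst

theorem fderiv_twistEquation_horizontal (z : E × ℝ) (v : E) :
    fderiv ℝ (fun z : E × ℝ => B (rotDir e₀ e₁ (w * z.2)) z.1) z (v, 0) =
      B (rotDir e₀ e₁ (w * z.2)) v := by
  have hd : DifferentiableAt ℝ (fun z : E × ℝ => B (rotDir e₀ e₁ (w * z.2)) z.1) z :=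
    contDiff_twistEquation.contDiffAt.differentiableAt (n := ∞) (by simp)
  have hN' : HasFDerivAt (fun z : E × ℝ => B (rotDir e₀ e₁ (w * z.2)) z.1)
      (fderiv ℝ (fun z : E × ℝ => B (rotDir e₀ e₁ (w * z.2)) z.1) z)
      (z + (0 : ℝ) • ((v, 0) : E × ℝ)) := by simpa using hd.hasFDerivAt
  have h1 := hN'.comp_hasDerivAt 0 (hasDerivAt_line z (v, 0))
  refine h1.unique ?_
  have h2 := hasDerivAt_bilin B (hasDerivAt_rotDir_line (e₀ := e₀) (e₁ := e₁) (w := w) z.2 0)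
    (hasDerivAt_line z.1 v)
  exact h2.congr_deriv (by simp)

theorem IsQuadric.isHypersurface_twist (hQ : IsQuadric B κ Q) (he : IsOrthonormalPair B e₀ e₁) :
    IsHypersurface (prodLine Q) (twist B Q e₀ e₁ w) := by
  refine ⟨fun z hz => ⟨hz.1, trivial⟩, fun z hz => ⟨Set.univ,
    fun z => B (rotDir e₀ e₁ (w * z.2)) z.1, isOpen_univ, trivial,
    contDiff_twistEquation.contDiffOn, ?_, (rotDir e₀ e₁ (w * z.2), 0),
    mem_tangentSpace_prodLine hz.1 (hQ.rotDir_mem_tangentSpace hz), ?_⟩⟩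
  · ext y; simp [twist, prodLine]
  · rw [fderiv_twistEquation_horizontal, he.dir_dir]
    exact one_ne_zero

/-- The twist is the zero set of a continuous function on Q × ℝ, so its inclusion is a closed
embedding and hence proper. -/
theorem IsQuadric.isProperlyEmbedded_twist (hQ : IsQuadric B κ Q)
    (he : IsOrthonormalPair B e₀ e₁) :
    IsProperlyEmbeddedHypersurface (prodLine Q) (twist B Q e₀ e₁ w) := by
  refine ⟨hQ.isHypersurface_twist he, (hQ.isHypersurface_twist he).1, ?_⟩
  refine (Topology.IsClosedEmbedding.mk (Topology.IsEmbedding.inclusion _) ?_).isProperMap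
  have : Set.range (Set.inclusion (hQ.isHypersurface_twist (w := w) he).1) =
      {z : prodLine Q | B (rotDir e₀ e₁ (w * z.1.2)) z.1.1 = 0} := by
    rw [Set.range_inclusion]
    ext z
    exact ⟨fun h => h.2, fun h => ⟨z.2.1, h⟩⟩
  rw [this]
  exact isClosed_eq (contDiff_twistEquation.continuous.comp continuous_subtype_val)
    continuous_const

theorem twist_inter_slice (t : ℝ) :
    twist B Q e₀ e₁ w ∩ slice Q t = hyperplaneSection B Q (rotDir e₀ e₁ (w * t)) ×ˢ {t} := by
  ext ⟨x, s⟩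
  simp only [twist, slice, hyperplaneSection, Set.mem_inter_iff, Set.mem_ofPred_eq, Set.mem_prod,
    Set.mem_singleton_iff]
  constructor
  · rintro ⟨⟨h1, h2⟩, -, rfl⟩; exact ⟨⟨h1, h2⟩, rfl⟩
  · rintro ⟨⟨h1, h2⟩, rfl⟩; exact ⟨⟨h1, h2⟩, h1, rfl⟩

theorem IsQuadric.isVerticalHelicoid_twist (hQ : IsQuadric B κ Q)
    (he : IsOrthonormalPair B e₀ e₁) (hw : 0 < w)
    (hp : ∃ p ∈ Q, B e₀ p = 0 ∧ B e₁ p = 1) (hq : ∃ q ∈ Q, B e₀ q = 0 ∧ B e₁ q = 0) :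
    IsVerticalHelicoid (fun x y => B x y) Q (twist B Q e₀ e₁ w) := by
  have hε : (1 : ℝ) ^ 2 = 1 := one_pow 2
  refine ⟨hQ.isHypersurface_twist he, fun z hz h => ?_, fun t => ?_, Set.univ,
    unitConormal B e₀ e₁ w 1, Set.subset_univ _, ?_, ?_, fun z hz => ?_⟩
  · exact one_ne_zero (h _ (hQ.ascent_mem he hz))
  · rw [twist_inter_slice]
    exact (hQ.isTotallyGeodesic_hyperplaneSection (he.dir_dir _)).isMinimalHypersurface_slice
      (by simp) t
  · rw [riemProd_eq_prodForm, ← conormalDomain_one (B := B) (e₀ := e₀) (e₁ := e₁) (w := w)]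
    exact hQ.isUnitNormalOn_unitConormal he hε
  · obtain ⟨p, hp, hp0, hp1⟩ := hp
    obtain ⟨q, hq, hq0, hq1⟩ := hq
    -- The angle is w/√(1 + w²) over `p`, where u = 1, and 0 over `q`, where u = 0.
    refine ⟨(p, 0), ⟨hp, by simp [rotDir, hp0]⟩, (q, 0), ⟨hq, by simp [rotDir, hq0]⟩, ?_⟩
    have h1 : axisDist B e₀ e₁ w (p, 0) = 1 := by simp [axisDist, rotNormal, hp1]
    have h2 : axisDist B e₀ e₁ w (q, 0) = 0 := by simp [axisDist, rotNormal, hq1]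
    have h3 : angle (fun x y => B x y) (unitConormal B e₀ e₁ w 1) (q, 0) = 0 := by
      simp [angle, riemProd, unitConormal, conormal, h2]
    have h4 : angle (fun x y => B x y) (unitConormal B e₀ e₁ w 1) (p, 0) =
        (Real.sqrt (1 + w ^ 2))⁻¹ * w := by
      simp [angle, riemProd, unitConormal, conormal, conormalScale, h1]
    rw [h3, h4]
    positivity
  · have hzU : z ∈ conormalDomain B e₀ e₁ w 1 := by rw [conormalDomain_one]; trivial
    have hpos : 0 < 1 + (w * axisDist B e₀ e₁ w z) ^ 2 := hzU
    have hmem := Submodule.smul_mem _ (1 + (w * axisDist B e₀ e₁ w z) ^ 2)⁻¹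
      (hQ.ascent_mem he hz)
    refine ⟨_, ⟨hmem, fun X hX => ?_⟩, ?_⟩
    · rw [riemProd_eq_prodForm, prodForm_smul_left, hQ.prodForm_ascent he hz hX,
        inv_mul_cancel_left₀ hpos.ne']
    · rw [riemProd_eq_prodForm, hQ.secondForm_unitConormal he hε hz hzU hmem]
      simp only [Prod.smul_fst, map_smul, he.normal_ascent]
      simp

theorem IsQuadric.isZeroMeanIsocurved_twist [FiniteDimensional ℝ E] (hQ : IsQuadric B κ Q)
    (he : IsOrthonormalPair B e₀ e₁) :
    IsZeroMeanIsocurved (fun x y => B x y) Q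
      (twist B Q e₀ e₁ w ∩ conormalDomain B e₀ e₁ w (-1)) := by
  have hO : IsOpen (conormalDomain B e₀ e₁ w (-1)) := isOpen_conormalDomain
  have hnormal : ∀ ε : ℝ, ε ^ 2 = 1 →
      conormalDomain B e₀ e₁ w (-1) ⊆ conormalDomain B e₀ e₁ w ε →
      IsUnitNormalOn (prodForm B ε) ε (prodLine Q)
        (twist B Q e₀ e₁ w ∩ conormalDomain B e₀ e₁ w (-1))
        (conormalDomain B e₀ e₁ w (-1)) (unitConormal B e₀ e₁ w ε) := fun ε hε hsub => by
    obtain ⟨-, h2, h3⟩ := hQ.isUnitNormalOn_unitConormal (w := w) he hε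
    refine ⟨hO, h2.mono hsub, fun z hz hzU => ?_⟩
    rw [tangentSpace_inter_open hO hzU]
    exact h3 z hz.1 (hsub hzU)
  have hmean : ∀ ε : ℝ, ε ^ 2 = 1 →
      conormalDomain B e₀ e₁ w (-1) ⊆ conormalDomain B e₀ e₁ w ε →
      ∀ z ∈ twist B Q e₀ e₁ w ∩ conormalDomain B e₀ e₁ w (-1),
      HasMeanCurvatureAt (prodForm B ε) (twist B Q e₀ e₁ w ∩ conormalDomain B e₀ e₁ w (-1))
        (unitConormal B e₀ e₁ w ε) z 0 := fun ε hε hsub z hz => by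
    have := hQ.hasMeanCurvatureAt_twist he hε hz.1 (hsub hz.2)
    exact this.congr (tangentSpace_inter_open hO hz.2).symm
  have hsub : conormalDomain B e₀ e₁ w (-1) ⊆ conormalDomain B e₀ e₁ w 1 := by
    rw [conormalDomain_one]; exact Set.subset_univ _
  refine ⟨(hQ.isHypersurface_twist he).inter_open hO, fun z hz X hX hX0 => ?_,
    conormalDomain B e₀ e₁ w (-1), unitConormal B e₀ e₁ w 1, unitConormal B e₀ e₁ w (-1),
    Set.inter_subset_right, ?_, ?_, fun z hz => ⟨?_, ?_⟩⟩
  · rw [tangentSpace_inter_open hO hz.2, hQ.mem_tangentSpace_twist_iff he hz.1] at hX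
    obtain ⟨h1, h2⟩ := hX
    have hdom : 0 < -1 + (w * B (rotNormal e₀ e₁ (w * z.2)) z.1) ^ 2 := hz.2
    have hη := he.dir_dir (w * z.2)
    have hxη := hz.1.2
    set η := rotDir e₀ e₁ (w * z.2) with hηdef
    set u := B (rotNormal e₀ e₁ (w * z.2)) z.1 with hu
    -- Splitting off the η-component, which tangency equates to -wuτ with τ = X.2, turns the
    -- Lorentzian square of `X` into B(Y,Y) + ((wu)² - 1)τ².
    set Y := X.1 - B η X.1 • η with hY
    have hYt : κ * B z.1 Y = 0 := by
      rw [hY, map_sub, map_smul, hQ.symm z.1 η, hxη]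
      simpa using h1
    have hdec : B X.1 X.1 = B Y Y + (B η X.1) ^ 2 := by
      simp only [hY, map_sub, map_smul, sub_apply, smul_apply, smul_eq_mul, hη,
        hQ.symm X.1 η]
      ring
    have hYnn : 0 ≤ B Y Y := by
      by_cases h : Y = 0
      · simp [h]
      · exact (hQ.pos _ hz.1.1 _ hYt h).le
    have hval : B η X.1 = -(w * X.2 * u) := by linarith
    have hgoal : lorProd (fun x y => B x y) X X = B Y Y + (-1 + (w * u) ^ 2) * X.2 ^ 2 := by
      simp only [lorProd, hdec, hval]
      ring
    rw [hgoal]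
    -- A horizontal vector is positive because `Q` is Riemannian; otherwise the second term is
    -- strictly positive.
    by_cases hτ : X.2 = 0
    · have hX1 : X.1 ≠ 0 := fun h => hX0 (Prod.ext h hτ)
      have hYX : Y = X.1 := by simp [hY, hval, hτ]
      have := hQ.pos _ hz.1.1 _ h1 hX1
      rw [hYX, hτ]
      simpa using this
    · have := mul_pos hdom (pow_pos (abs_pos.2 hτ) 2)
      rw [sq_abs] at this
      linarith
  · rw [riemProd_eq_prodForm]; exact hnormal 1 (by norm_num) hsub
  · rw [lorProd_eq_prodForm]; exact hnormal (-1) (by norm_num) subset_rfl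
  · rw [riemProd_eq_prodForm]; exact hmean 1 (by norm_num) hsub z hz
  · rw [lorProd_eq_prodForm, neg_zero]; exact hmean (-1) (by norm_num) subset_rfl z hz

end Twist

/-! ## Block rotations and diagonal forms -/

section Diagonal

variable {m d : ℕ}

/-- The diagonal bilinear form with weights `wt`. -/
def diagForm (wt : Fin m → ℝ) : (Fin m → ℝ) →L[ℝ] (Fin m → ℝ) →L[ℝ] ℝ :=
  ∑ i, wt i • (ContinuousLinearMap.proj (R := ℝ) (φ := fun _ : Fin m => ℝ) i).smulRight
    (ContinuousLinearMap.proj (R := ℝ) (φ := fun _ : Fin m => ℝ) i)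

theorem diagForm_apply (wt x y : Fin m → ℝ) : diagForm wt x y = ∑ i, wt i * (x i * y i) := by
  simp [diagForm]

theorem diagForm_symm (wt x y : Fin m → ℝ) : diagForm wt x y = diagForm wt y x := by
  simp only [diagForm_apply, mul_comm (x _)]

theorem diagForm_single (wt : Fin m → ℝ) (i : Fin m) (x : Fin m → ℝ) :
    diagForm wt (Pi.single i 1) x = wt i * x i := by
  rw [diagForm_apply, Finset.sum_eq_single i]
  · simp
  · intro j _ hj; simp [hj]
  · simp

/-- The coordinate that a block rotation mixes with the `i`-th one. -/
def partner (h : d ≤ m) (i : Fin m) : Fin m :=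
  if hi : 2 * (i.val / 2) + 1 < d then
    if h2 : i.val % 2 = 0 then ⟨i.val + 1, by omega⟩ else ⟨i.val - 1, by omega⟩
  else i

/-- The sign of the off-diagonal entry of the `i`-th row of a block rotation. -/
def rowSign (i : Fin m) : ℝ := if i.val % 2 = 0 then -1 else 1

theorem rowSign_sq (i : Fin m) : rowSign i * rowSign i = 1 := by
  unfold rowSign; split_ifs <;> norm_num

/-- Partners share a block index, so the condition of lying in a rotated block is invariant under
`partner`. -/
theorem partner_val_div (h : d ≤ m) (i : Fin m) : (partner h i).val / 2 = i.val / 2 := by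
  unfold partner
  split_ifs
  · simp only; omega
  · simp only; omega
  · rfl

theorem partner_partner (h : d ≤ m) (i : Fin m) : partner h (partner h i) = i := by
  by_cases hi : 2 * (i.val / 2) + 1 < d
  · have hi' : 2 * ((partner h i).val / 2) + 1 < d := by rwa [partner_val_div]
    apply Fin.ext
    rw [partner, dif_pos hi']
    rcases Nat.mod_two_eq_zero_or_one i.val with h2 | h2
    · have : (partner h i).val = i.val + 1 := by rw [partner, dif_pos hi, dif_pos h2]
      rw [dif_neg (by omega)]; simp only; omega
    · have : (partner h i).val = i.val - 1 := by rw [partner, dif_pos hi, dif_neg (by omega)]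
      rw [dif_pos (by omega)]; simp only; omega
  · have : partner h i = i := by rw [partner, dif_neg hi]
    rw [this, this]

theorem rowSign_partner (h : d ≤ m) {i : Fin m} (hi : 2 * (i.val / 2) + 1 < d) :
    rowSign (partner h i) = -rowSign i := by
  rcases Nat.mod_two_eq_zero_or_one i.val with h2 | h2
  · have : (partner h i).val = i.val + 1 := by rw [partner, dif_pos hi, dif_pos h2]
    rw [rowSign, rowSign, if_neg (by omega), if_pos h2, neg_neg]
  · have : (partner h i).val = i.val - 1 := by rw [partner, dif_pos hi, dif_neg (by omega)]
    rw [rowSign, rowSign, if_pos (by omega), if_neg (by omega)]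

/-- With the involution and the sign, even and odd rows take one form, and later identities need no
parity cases. -/
theorem blockRotation_apply (h : d ≤ m) (φ : ℝ) (x : Fin m → ℝ) (i : Fin m) :
    blockRotation m d φ x i = if 2 * (i.val / 2) + 1 < d then
      Real.cos φ * x i + rowSign i * (Real.sin φ * x (partner h i)) else x i := by
  unfold blockRotation
  split_ifs with hi h2
  · have hlt : i.val + 1 < m := by omega
    have hp : partner h i = ⟨i.val + 1, hlt⟩ := by rw [partner, dif_pos hi, dif_pos h2]
    rw [coord, dif_pos hlt, hp, rowSign, if_pos h2]; ring
  · have hlt : i.val - 1 < m := by omega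
    have hp : partner h i = ⟨i.val - 1, hlt⟩ := by rw [partner, dif_pos hi, dif_neg h2]
    rw [coord, dif_pos hlt, hp, rowSign, if_neg h2]; ring
  · rfl

theorem blockRotation_zero (h : d ≤ m) (x : Fin m → ℝ) : blockRotation m d 0 x = x := by
  funext i
  rw [blockRotation_apply h]
  simp

theorem blockRotation_add (h : d ≤ m) (φ ψ : ℝ) (x : Fin m → ℝ) :
    blockRotation m d (φ + ψ) x = blockRotation m d φ (blockRotation m d ψ x) := by
  funext i
  simp only [blockRotation_apply h, partner_val_div, partner_partner]
  split_ifs with hi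
  · rw [rowSign_partner h hi, Real.cos_add, Real.sin_add]
    linear_combination (Real.sin φ * Real.sin ψ * x i) * rowSign_sq i
  · rfl

/-- A block rotation as a continuous linear map. -/
def blockRotationCLM (h : d ≤ m) (φ : ℝ) : (Fin m → ℝ) →L[ℝ] (Fin m → ℝ) :=
  LinearMap.toContinuousLinearMap
    { toFun := blockRotation m d φ
      map_add' := fun x y => by
        funext i
        simp only [blockRotation_apply h, Pi.add_apply]
        split_ifs <;> ring
      map_smul' := fun r x => by
        funext i
        simp only [blockRotation_apply h, Pi.smul_apply, smul_eq_mul, RingHom.id_apply]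
        split_ifs <;> ring }

theorem fderiv_blockRotation (h : d ≤ m) (φ : ℝ) (x X : Fin m → ℝ) :
    fderiv ℝ (blockRotation m d φ) x X = blockRotation m d φ X := by
  have : HasFDerivAt (blockRotation m d φ) (blockRotationCLM h φ) x :=
    (blockRotationCLM h φ).hasFDerivAt
  rw [this.fderiv]
  rfl

theorem contDiff_blockRotation (h : d ≤ m) (k : ℝ) :
    ContDiff ℝ ∞ (fun z : ℝ × (Fin m → ℝ) => blockRotation m d (k * z.1) z.2) := by
  rw [contDiff_pi]
  intro i
  simp only [blockRotation_apply h]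
  have hc : ∀ j, ContDiff ℝ ∞ (fun z : ℝ × (Fin m → ℝ) => z.2 j) := fun j =>
    (contDiff_apply ℝ ℝ j).comp contDiff_snd
  have hk : ContDiff ℝ ∞ (fun z : ℝ × (Fin m → ℝ) => k * z.1) :=
    contDiff_const.mul contDiff_fst
  split_ifs
  · exact ((Real.contDiff_cos.comp hk).mul (hc i)).add
      (contDiff_const.mul ((Real.contDiff_sin.comp hk).mul (hc _)))
  · exact hc i

theorem diagForm_blockRotation (h : d ≤ m) {wt : Fin m → ℝ}
    (hwt : ∀ i : Fin m, i.val < d → wt i = 1) (φ : ℝ) (x y : Fin m → ℝ) :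
    diagForm wt (blockRotation m d φ x) (blockRotation m d φ y) = diagForm wt x y := by
  have hsum : ∀ f : Fin m → ℝ, ∑ i, f (partner h i) = ∑ i, f i := fun f =>
    Equiv.sum_comp (Function.Involutive.toPerm _ (partner_partner h)) f
  -- Summing over i and over its partner gives the same total, so it suffices to compare the
  -- two-term sums of each block, where the identity is cos² + sin² = 1.
  have key : ∀ f f' : Fin m → ℝ, (∀ i, f i + f (partner h i) = f' i + f' (partner h i)) →
      ∑ i, f i = ∑ i, f' i := fun f f' hff => by
    have h1 : ∑ i, (f i + f (partner h i)) = ∑ i, (f' i + f' (partner h i)) :=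
      Finset.sum_congr rfl fun i _ => hff i
    rw [Finset.sum_add_distrib, Finset.sum_add_distrib, hsum, hsum] at h1
    linarith
  rw [diagForm_apply, diagForm_apply]
  refine key _ _ fun i => ?_
  simp only [blockRotation_apply h, partner_val_div, partner_partner]
  split_ifs with hi
  · have h1 : wt i = 1 := hwt i (by omega)
    have h2 : wt (partner h i) = 1 := hwt _ (by have := partner_val_div h i; omega)
    rw [h1, h2, rowSign_partner h hi]
    linear_combination (x i * y i + x (partner h i) * y (partner h i)) *
      (Real.sin_sq_add_cos_sq φ) + Real.sin φ ^ 2 *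
      (x i * y i + x (partner h i) * y (partner h i)) * rowSign_sq i
  · rfl

theorem isOneParameterIsometryGroup_blockRotation (h : d ≤ m) {wt : Fin m → ℝ}
    (hwt : ∀ i : Fin m, i.val < d → wt i = 1) {Q : Set (Fin m → ℝ)}
    (hQ : ∀ φ, Set.MapsTo (blockRotation m d φ) Q Q) (k : ℝ) :
    IsOneParameterIsometryGroup (fun x y => diagForm wt x y) Q
      (fun s => blockRotation m d (k * s)) := by
  refine ⟨fun s => ⟨?_, ⟨Set.univ, isOpen_univ, Set.subset_univ _, ?_⟩, fun x _ X _ Y _ => ?_⟩,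
    fun x _ => ?_, fun s t x _ => ?_, Set.univ, isOpen_univ, Set.subset_univ _,
    (contDiff_blockRotation h k).contDiffOn⟩
  · refine Set.InvOn.bijOn (f' := blockRotation m d (-(k * s))) ⟨fun x _ => ?_, fun x _ => ?_⟩
      (hQ _) (hQ _)
    · rw [← blockRotation_add h, neg_add_cancel, blockRotation_zero h]
    · change blockRotation m d (k * s) _ = x
      rw [← blockRotation_add h, add_neg_cancel, blockRotation_zero h]
  · exact (blockRotationCLM h (k * s)).contDiff.contDiffOn
  · simp only [fderiv_blockRotation h]
    exact diagForm_blockRotation h hwt _ _ _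
  · simp only [mul_zero]; exact blockRotation_zero h x
  · simp only [mul_add]; exact blockRotation_add h _ _ x

theorem isOrthonormalPair_single {wt : Fin m → ℝ} {i j : Fin m} (hij : i ≠ j) (hi : wt i = 1)
    (hj : wt j = 1) : IsOrthonormalPair (diagForm wt) (Pi.single i 1) (Pi.single j 1) where
  symm := diagForm_symm wt
  left := by simp [diagForm_single, hi]
  right := by simp [diagForm_single, hj]
  orth := by simp [diagForm_single, hij]

/-- The rotated direction is the image of e₀ under the block rotation, which is an isometry of the
form. -/
theorem diagForm_rotDir_blockRotation (hd : 2 ≤ d) (h : d ≤ m) {wt : Fin m → ℝ}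
    (hwt : ∀ i : Fin m, i.val < d → wt i = 1) (φ : ℝ) (x : Fin m → ℝ) :
    diagForm wt (rotDir (Pi.single ⟨0, by omega⟩ 1) (Pi.single ⟨1, by omega⟩ 1) φ)
      (blockRotation m d φ x) = diagForm wt (Pi.single ⟨0, by omega⟩ 1) x := by
  have h0 : wt ⟨0, by omega⟩ = 1 := hwt _ (by simp only; omega)
  have h1 : wt ⟨1, by omega⟩ = 1 := hwt _ (by simp only; omega)
  have hR : blockRotation m d φ (Pi.single ⟨0, by omega⟩ 1) =
      rotDir (Pi.single ⟨0, by omega⟩ 1) (Pi.single ⟨1, by omega⟩ 1) φ := by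
    funext i
    have hs : ∀ (j : ℕ) (hj : j < m) (i : Fin m),
        (Pi.single (⟨j, hj⟩ : Fin m) (1 : ℝ) : Fin m → ℝ) i = if i.val = j then 1 else 0 := by
      intro j hj i
      simp only [Pi.single_apply, Fin.ext_iff]
    simp only [blockRotation_apply h, rotDir, Pi.add_apply, Pi.smul_apply, smul_eq_mul, hs]
    by_cases hi : 2 * (i.val / 2) + 1 < d
    · rw [if_pos hi]
      rcases Nat.mod_two_eq_zero_or_one i.val with h2 | h2
      · have hp : (partner h i).val = i.val + 1 := by rw [partner, dif_pos hi, dif_pos h2]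
        rw [hp, if_neg (by omega : ¬ i.val + 1 = 0), if_neg (by omega : ¬ i.val = 1)]
        ring
      · have hp : (partner h i).val = i.val - 1 := by
          rw [partner, dif_pos hi, dif_neg (by omega)]
        rw [hp, if_neg (by omega : ¬ i.val = 0), rowSign, if_neg (by omega)]
        by_cases h3 : i.val = 1
        · rw [if_pos h3, if_pos (by omega)]; ring
        · rw [if_neg h3, if_neg (by omega)]; ring
    · rw [if_neg hi, if_neg (by omega), if_neg (by omega)]; ring
  rw [← hR, diagForm_blockRotation h hwt]

/-- At height t = as the rotation angle is ks = (k/a)t, which explains the speed k/a. -/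
theorem pitchedTwisting_blockRotation (hd : 2 ≤ d) (h : d ≤ m) {wt : Fin m → ℝ}
    (hwt : ∀ i : Fin m, i.val < d → wt i = 1) {Q : Set (Fin m → ℝ)}
    (hQ : ∀ φ, Set.MapsTo (blockRotation m d φ) Q Q) {a : ℝ} (ha : 0 < a) (k : ℝ) :
    twist (diagForm wt) Q (Pi.single ⟨0, by omega⟩ 1) (Pi.single ⟨1, by omega⟩ 1) (k / a) =
      pitchedTwisting a (fun s => blockRotation m d (k * s))
        (hyperplaneSection (diagForm wt) Q (Pi.single ⟨0, by omega⟩ 1)) := by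
  ext ⟨x, t⟩
  constructor
  · rintro ⟨hx, hxt⟩
    simp only at hx hxt
    have e : k * (t / a) = k / a * t := by ring
    have hx' : blockRotation m d (k * (t / a)) (blockRotation m d (-(k * (t / a))) x) = x := by
      rw [← blockRotation_add h, add_neg_cancel, blockRotation_zero h]
    refine ⟨blockRotation m d (-(k * (t / a))) x, ⟨hQ _ hx, ?_⟩, t / a, ?_⟩
    · rw [← diagForm_rotDir_blockRotation hd h hwt (k * (t / a)), hx', e, hxt]
    · exact Prod.ext hx'.symm (mul_div_cancel₀ _ ha.ne').symm
  · rintro ⟨p, ⟨hp, hp0⟩, s, hz⟩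
    obtain ⟨rfl, rfl⟩ := Prod.ext_iff.1 hz
    refine ⟨hQ _ hp, ?_⟩
    have e : k / a * (a * s) = k * s := by field_simp
    simp only
    rw [e, diagForm_rotDir_blockRotation hd h hwt, hp0]

theorem exists_helicoids_of_isQuadric (hd : 2 ≤ d) (h : d ≤ m) {wt : Fin m → ℝ}
    (hwt : ∀ i : Fin m, i.val < d → wt i = 1) {κ : ℝ} {Q : Set (Fin m → ℝ)}
    (hQ : IsQuadric (diagForm wt) κ Q)
    (hmaps : ∀ φ, Set.MapsTo (blockRotation m d φ) Q Q)
    (hp : ∃ p ∈ Q, p ⟨0, by omega⟩ = 0 ∧ p ⟨1, by omega⟩ = 1)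
    (hq : ∃ q ∈ Q, q ⟨0, by omega⟩ = 0 ∧ q ⟨1, by omega⟩ = 0) :
    (∀ k : ℝ, 0 < k → IsOneParameterIsometryGroup (fun x y => diagForm wt x y) Q
      (fun s => blockRotation m d (k * s))) ∧
    ∃ (S₀ : Set (Fin m → ℝ)) (S : ℝ → ℝ → Set ((Fin m → ℝ) × ℝ)),
      IsTotallyGeodesicHypersurface (fun x y => diagForm wt x y) Q S₀ ∧
      (∀ a k : ℝ, 0 < a → 0 < k →
        S a k = pitchedTwisting a (fun s => blockRotation m d (k * s)) S₀ ∧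
        IsProperlyEmbeddedHypersurface (prodLine Q) (S a k) ∧
        IsVerticalHelicoid (fun x y => diagForm wt x y) Q (S a k) ∧
        ∀ t : ℝ, ∃ L : Set (Fin m → ℝ),
          IsTotallyGeodesicHypersurface (fun x y => diagForm wt x y) Q L ∧
          S a k ∩ slice Q t = L ×ˢ {t}) ∧
      ∀ a : ℝ, 0 < a → ∃ k : ℝ, 0 < k ∧ ∃ O : Set ((Fin m → ℝ) × ℝ), IsOpen O ∧
        (S a k ∩ O).Nonempty ∧
        IsZeroMeanIsocurved (fun x y => diagForm wt x y) Q (S a k ∩ O) := by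
  have h0 : wt ⟨0, by omega⟩ = 1 := hwt _ (by simp only; omega)
  have h1 : wt ⟨1, by omega⟩ = 1 := hwt _ (by simp only; omega)
  have he : IsOrthonormalPair (diagForm wt) (Pi.single ⟨0, by omega⟩ 1)
      (Pi.single ⟨1, by omega⟩ 1) := isOrthonormalPair_single (by simp) h0 h1
  have hp' : ∃ p ∈ Q, diagForm wt (Pi.single ⟨0, by omega⟩ 1) p = 0 ∧
      diagForm wt (Pi.single ⟨1, by omega⟩ 1) p = 1 := by
    obtain ⟨p, hp, hp0, hp1⟩ := hp
    exact ⟨p, hp, by rw [diagForm_single, hp0, mul_zero],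
      by rw [diagForm_single, hp1, h1, mul_one]⟩
  have hq' : ∃ q ∈ Q, diagForm wt (Pi.single ⟨0, by omega⟩ 1) q = 0 ∧
      diagForm wt (Pi.single ⟨1, by omega⟩ 1) q = 0 := by
    obtain ⟨q, hq, hq0, hq1⟩ := hq
    exact ⟨q, hq, by rw [diagForm_single, hq0, mul_zero],
      by rw [diagForm_single, hq1, mul_zero]⟩
  refine ⟨fun k _ => isOneParameterIsometryGroup_blockRotation h hwt hmaps k,
    hyperplaneSection (diagForm wt) Q (Pi.single ⟨0, by omega⟩ 1),
    fun a k => twist (diagForm wt) Q (Pi.single ⟨0, by omega⟩ 1) (Pi.single ⟨1, by omega⟩ 1)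
      (k / a), hQ.isTotallyGeodesic_hyperplaneSection he.left, fun a k ha hk =>
    ⟨pitchedTwisting_blockRotation hd h hwt hmaps ha k, hQ.isProperlyEmbedded_twist he,
      hQ.isVerticalHelicoid_twist he (div_pos hk ha) hp' hq', fun t =>
      ⟨_, hQ.isTotallyGeodesic_hyperplaneSection (he.dir_dir _), twist_inter_slice t⟩⟩,
    -- With k = 2a the speed is w = 2; over `p`, where u = 1, one gets (wu)² - 1 = 3 > 0.
    fun a ha => ⟨2 * a, by positivity, _, isOpen_conormalDomain, ?_,
      hQ.isZeroMeanIsocurved_twist he⟩⟩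
  obtain ⟨p, hp, hp0, hp1⟩ := hp'
  refine ⟨(p, 0), ⟨hp, by simp [rotDir, hp0]⟩, ?_⟩
  have h2 : 2 * a / a = 2 := by field_simp
  simp only [conormalDomain, Set.mem_ofPred_eq, axisDist, rotNormal, h2]
  simp [hp1]

end Diagonal

/-! ## The space forms -/

/-- The diagonal entries of the ambient form. -/
def weight : (c : SpaceForm) → (n : ℕ) → Fin (ambDim c n) → ℝ
  | .euclidean, _ => fun _ => 1
  | .spherical, _ => fun _ => 1
  | .hyperbolic, n => fun i : Fin (n + 1) => if i = Fin.last n then -1 else 1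

theorem metric_eq_diagForm (c : SpaceForm) (n : ℕ) :
    metric c n = fun x y => diagForm (weight c n) x y := by
  funext x y
  rw [diagForm_apply]
  cases c with
  | euclidean => simp only [metric, weight, one_mul]; rfl
  | spherical => simp only [metric, weight, one_mul]; rfl
  | hyperbolic =>
    change _ = ∑ i : Fin (n + 1), weight .hyperbolic n i * (x i * y i)
    rw [Fin.sum_univ_castSucc]
    simp [metric, weight, (Fin.castSucc_lt_last _).ne]
    ring

/-- The curvature of a space form. -/
def curvature : SpaceForm → ℝ
  | .euclidean => 0
  | .spherical => 1
  | .hyperbolic => -1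

theorem sum_mul_self_pos {m : ℕ} {v : Fin m → ℝ} (hv : v ≠ 0) : 0 < ∑ i, v i * v i := by
  obtain ⟨i, hi⟩ := Function.ne_iff.1 hv
  exact Finset.sum_pos' (fun i _ => mul_self_nonneg _)
    ⟨i, Finset.mem_univ _, mul_self_pos.2 hi⟩

/-- The Lorentz form is positive on vectors orthogonal to a unit timelike vector. -/
theorem metric_hyperbolic_pos {n : ℕ} {x v : Fin (n + 1) → ℝ}
    (hx : metric .hyperbolic n x x = -1) (hxv : metric .hyperbolic n x v = 0) (hv : v ≠ 0) :
    0 < metric .hyperbolic n v v := by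
  simp only [metric] at hx hxv ⊢
  -- Cauchy–Schwarz on the spatial parts reads C² ≤ AD. With C = x_n v_n and A = x_n² - 1 it becomes
  -- D ≤ x_n²(D - v_n²), so the claim follows from D > 0.
  have hcs := Finset.sum_mul_sq_le_sq_mul_sq Finset.univ (fun i : Fin n => x i.castSucc)
    (fun i : Fin n => v i.castSucc)
  simp only [pow_two (x _), pow_two (v _)] at hcs
  set A := ∑ i : Fin n, x i.castSucc * x i.castSucc
  set C := ∑ i : Fin n, x i.castSucc * v i.castSucc
  set D := ∑ i : Fin n, v i.castSucc * v i.castSucc with hD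
  have hDnn : 0 ≤ D := Finset.sum_nonneg fun i _ => mul_self_nonneg _
  have hA : A = x (Fin.last n) * x (Fin.last n) - 1 := by linarith
  have hAnn : 0 ≤ A := Finset.sum_nonneg fun i _ => mul_self_nonneg _
  have hC : C = x (Fin.last n) * v (Fin.last n) := by linarith
  have hDpos : 0 < D := by
    refine lt_of_le_of_ne hDnn fun h0 => hv ?_
    have hz := (Finset.sum_eq_zero_iff_of_nonneg
      (fun (i : Fin n) _ => mul_self_nonneg (v i.castSucc))).1 h0.symm
    have hC0 : C = 0 := by
      rw [← h0, mul_zero] at hcs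
      exact pow_eq_zero_iff two_ne_zero |>.1 (le_antisymm hcs (sq_nonneg _))
    have hxl : x (Fin.last n) ≠ 0 := fun h => by rw [h] at hA; linarith
    have hvl : v (Fin.last n) = 0 := by
      rw [hC0] at hC
      exact (mul_eq_zero.1 hC.symm).resolve_left hxl
    funext i
    refine Fin.lastCases hvl (fun j => ?_) i
    exact mul_self_eq_zero.1 (hz j (Finset.mem_univ _))
  have hxx : 0 < x (Fin.last n) * x (Fin.last n) := by linarith
  have hmul : D ≤ (x (Fin.last n) * x (Fin.last n)) *
      (D - v (Fin.last n) * v (Fin.last n)) := by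
    rw [hC, hA] at hcs
    nlinarith
  exact pos_of_mul_pos_right (lt_of_lt_of_le hDpos hmul) hxx.le

theorem isQuadric_Q (c : SpaceForm) (n : ℕ) :
    IsQuadric (diagForm (weight c n)) (curvature c) (Q c n) := by
  have hm : ∀ x y, diagForm (weight c n) x y = metric c n x y := fun x y => by
    rw [metric_eq_diagForm]
  refine ⟨diagForm_symm _, ?_, ?_, fun x hx v hv hv0 => ?_⟩
  · cases c <;> norm_num [curvature]
  · simp only [hm]
    cases c with
    | euclidean => exact ⟨Set.univ, isOpen_univ, by simp [Q, curvature]⟩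
    | spherical => exact ⟨Set.univ, isOpen_univ, by simp [Q, curvature]⟩
    | hyperbolic =>
      -- The open half-space selects the upper sheet.
      refine ⟨{x : Fin (n + 1) → ℝ | 0 < x (Fin.last n)},
        isOpen_lt continuous_const (continuous_apply _), fun x => ?_⟩
      simp only [Q, curvature]
      constructor
      · rintro ⟨h1, h2⟩; exact ⟨h2, by rw [h1]; norm_num⟩
      · rintro ⟨h1, h2⟩; exact ⟨by linarith, h1⟩
  · rw [hm] at hv ⊢
    cases c with
    | euclidean => exact sum_mul_self_pos hv0
    | spherical => exact sum_mul_self_pos hv0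
    | hyperbolic =>
      simp only [curvature] at hv
      exact metric_hyperbolic_pos hx.1 (by linarith) hv0

theorem rotDim_le_ambDim (c : SpaceForm) (n : ℕ) : rotDim c n ≤ ambDim c n := by
  cases c <;> simp [rotDim, ambDim]

theorem two_le_rotDim (c : SpaceForm) {n : ℕ} (hn : 2 ≤ n) : 2 ≤ rotDim c n := by
  cases c <;> simp only [rotDim] <;> omega

theorem weight_eq_one (c : SpaceForm) (n : ℕ) (i : Fin (ambDim c n)) (hi : i.val < rotDim c n) :
    weight c n i = 1 := by
  cases c with
  | euclidean => rfl
  | spherical => rfl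
  | hyperbolic =>
    refine if_neg fun h => ?_
    have h' : i.val = n := congrArg Fin.val h
    simp only [rotDim] at hi
    omega

theorem mapsTo_blockRotation_Q (c : SpaceForm) (n : ℕ) (φ : ℝ) :
    Set.MapsTo (blockRotation (ambDim c n) (rotDim c n) φ) (Q c n) (Q c n) := by
  intro x hx
  have hm : metric c n (blockRotation (ambDim c n) (rotDim c n) φ x)
      (blockRotation (ambDim c n) (rotDim c n) φ x) = metric c n x x := by
    rw [metric_eq_diagForm]
    exact diagForm_blockRotation (rotDim_le_ambDim c n) (weight_eq_one c n) φ x x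
  cases c with
  | euclidean => trivial
  | spherical => exact hm.trans hx
  | hyperbolic =>
    refine ⟨hm.trans hx.1, ?_⟩
    -- The timelike coordinate has index n and the blocks use only indices below n, so it is fixed
    -- and the sheet is preserved.
    have : blockRotation (n + 1) n φ x (Fin.last n) = x (Fin.last n) :=
      if_neg (by simp only [Fin.val_last]; omega)
    exact this.symm ▸ hx.2

theorem diagForm_pair {m : ℕ} (wt : Fin m → ℝ) {i j : Fin m} (hij : i ≠ j) (r b : ℝ) :
    diagForm wt (r • Pi.single i 1 + b • Pi.single j 1) (r • Pi.single i 1 + b • Pi.single j 1) =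
      wt i * r ^ 2 + wt j * b ^ 2 := by
  simp only [map_add, map_smul, add_apply, smul_apply, diagForm_single, smul_eq_mul,
    Pi.single_eq_same, Pi.single_eq_of_ne hij, Pi.single_eq_of_ne hij.symm]
  ring

/-- The values r = 1 and r = 0 supply the points showing that the angle varies; r = 1 also gives a
point of the spacelike region. -/
theorem exists_mem_Q (c : SpaceForm) {n : ℕ} (hn : 2 ≤ n) (r : ℝ) (hr : r = 0 ∨ r = 1)
    (h0 : 0 < ambDim c n) (h1 : 1 < ambDim c n) :
    ∃ p ∈ Q c n, p ⟨0, h0⟩ = 0 ∧ p ⟨1, h1⟩ = r := by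
  have key : ∀ (j : Fin (ambDim c n)) (b : ℝ), 2 ≤ j.val →
      (r • Pi.single ⟨1, h1⟩ 1 + b • Pi.single j 1 : Fin (ambDim c n) → ℝ) ∈ Q c n →
      ∃ p ∈ Q c n, p ⟨0, h0⟩ = 0 ∧ p ⟨1, h1⟩ = r := fun j b hj hmem => by
    have hj0 : (⟨0, h0⟩ : Fin (ambDim c n)) ≠ j := fun h => by
      rw [← h] at hj; simp at hj
    have hj1 : (⟨1, h1⟩ : Fin (ambDim c n)) ≠ j := fun h => by
      rw [← h] at hj; simp at hj
    refine ⟨_, hmem, ?_, ?_⟩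
    · simp [hj0]
    · simp [hj1]
  cases c with
  | euclidean => exact ⟨Pi.single ⟨1, h1⟩ r, trivial, by simp, by simp⟩
  | spherical =>
    -- A third coordinate exists since n ≥ 2, and r² + (1 - r)² = 1 for r = 0, 1.
    refine key ⟨2, by simp only [ambDim]; omega⟩ (1 - r) le_rfl ?_
    change metric .spherical n _ _ = 1
    rw [metric_eq_diagForm]
    refine (diagForm_pair _ (by simp) _ _).trans ?_
    rcases hr with rfl | rfl <;> simp [weight]
  | hyperbolic =>
    have hl : (⟨1, h1⟩ : Fin (n + 1)) ≠ Fin.last n := fun h => by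
      have := congrArg Fin.val h
      simp only [Fin.val_last] at this
      omega
    -- The timelike coordinate is forced by r² - b² = -1 with b > 0.
    refine key (Fin.last n) (Real.sqrt (1 + r ^ 2)) (by simpa using hn) ⟨?_, ?_⟩
    · rw [metric_eq_diagForm]
      refine (diagForm_pair (m := n + 1) _ hl _ _).trans ?_
      rw [Real.sq_sqrt (by positivity)]
      simp only [weight, if_neg hl, if_true]
      ring
    · have : (r • Pi.single ⟨1, h1⟩ 1 + Real.sqrt (1 + r ^ 2) • Pi.single (Fin.last n) 1 :
          Fin (n + 1) → ℝ) (Fin.last n) = Real.sqrt (1 + r ^ 2) := by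
        simp [hl.symm]
      exact this.symm ▸ Real.sqrt_pos.2 (by positivity)

end Helicoid

end

theorem mainTheorem3 (c : Helicoid.SpaceForm) (n : ℕ) (hn : 2 ≤ n) :
    (∀ k : ℝ, 0 < k → Helicoid.IsOneParameterIsometryGroup (Helicoid.metric c n)
      (Helicoid.Q c n) (Helicoid.Gam c n k)) ∧
    ∃ (S₀ : Set (Helicoid.Amb c n)) (S : ℝ → ℝ → Set (Helicoid.Amb c n × ℝ)),
      Helicoid.IsTotallyGeodesicHypersurface (Helicoid.metric c n) (Helicoid.Q c n) S₀ ∧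
      (∀ a k : ℝ, 0 < a → 0 < k →
        S a k = Helicoid.pitchedTwisting a (Helicoid.Gam c n k) S₀ ∧
        Helicoid.IsProperlyEmbeddedHypersurface (Helicoid.prodLine (Helicoid.Q c n)) (S a k) ∧
        Helicoid.IsVerticalHelicoid (Helicoid.metric c n) (Helicoid.Q c n) (S a k) ∧
        ∀ t : ℝ, ∃ L : Set (Helicoid.Amb c n),
          Helicoid.IsTotallyGeodesicHypersurface (Helicoid.metric c n) (Helicoid.Q c n) L ∧
          S a k ∩ Helicoid.slice (Helicoid.Q c n) t = L ×ˢ {t}) ∧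
      ∀ a : ℝ, 0 < a → ∃ k : ℝ, 0 < k ∧ ∃ O : Set (Helicoid.Amb c n × ℝ), IsOpen O ∧
        (S a k ∩ O).Nonempty ∧
        Helicoid.IsZeroMeanIsocurved (Helicoid.metric c n) (Helicoid.Q c n) (S a k ∩ O) := by
  rw [Helicoid.metric_eq_diagForm]
  exact Helicoid.exists_helicoids_of_isQuadric (Helicoid.two_le_rotDim c hn)
    (Helicoid.rotDim_le_ambDim c n) (Helicoid.weight_eq_one c n) (Helicoid.isQuadric_Q c n)
    (Helicoid.mapsTo_blockRotation_Q c n) (Helicoid.exists_mem_Q c hn 1 (Or.inr rfl) _ _)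
    (Helicoid.exists_mem_Q c hn 0 (Or.inl rfl) _ _)
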